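/- Let $\mathcal L\subset\mathbb R^d$ be a lattice, $\Lambda\subset\mathcal L$ any (finite or infinite) subset, and $J=(J_{xy})_{x,y\in\Lambda}$ a Hermitian matrix of complex numbers with $\sup_{x\in\Lambda}|J_{xx}|<\infty$. On the bosonic Fock space $\mathcal F=\bigoplus_{m\ge 0}\otimes_s^m\ell^2(\mathcal L)$, with the usual annihilation and creation operators $b_x,b_x^*$ and $n_x=b_x^*b_x$, consider for $g>0$, $\mu\in\mathbb R$ the Bose-Hubbard Hamiltonian $$H=-\sum_{x,y\in\Lambda}J_{xy}b_x^*b_y+\frac g2\sum_{x\in\Lambda}n_x(n_x-1)-\mu\sum_{x\in\Lambda}n_x ,$$ the direct sum of its restrictions to the $m$-particle spaces, which are bounded and self-adjoint under the hypotheses. Let $N=\sum_{x\in\Lambda}n_x$ and, for $S\subset\Lambda$, let $\mathrm d\Gamma(\chi_S)=\sum_{x\in S}n_x$ be the number of particles in $S$, with expectations $\langle\phi,\mathrm d\Gamma(\chi_S)\phi\rangle$ understood as quadratic forms. Set $\kappa_J^{(q)}=\sup_{x\in\Lambda}\sum_{y\in\Lambda}|J_{xy}||x-y|^q$ and $\kappa=\kappa_J^{(1)}$.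 Suppose that $\kappa_J^{(p)}<\infty$ for some integer $p\ge1$. Let $c>\kappa$ and let $0\le n\le p-1$ be an integer. Then for all $B>0$ and $\theta\in(0,1)$ there is a constant $C_n>0$, depending only on $n,c,\Lambda,J,B,\theta$, such that for all $g>0$, $\mu\in\mathbb R$, $\phi\in\mathcal D(N^{1/2})$, $0<b\le\max\{B,\theta\rho\}$, $t>0$ and $\rho>b+ct$, $$\langle e^{-itH}\phi,\mathrm d\Gamma(\chi_{|x|>\rho})e^{-itH}\phi\rangle\le\langle\phi,\mathrm d\Gamma(\chi_{|x|>b})\phi\rangle+C_n\rho^{-n}\langle\phi,N\phi\rangle,$$ $$\langle e^{-itH}\phi,\mathrm d\Gamma(\chi_{|x|<b})e^{-itH}\phi\rangle\le\langle\phi,\mathrm d\Gamma(\chi_{|x|<\rho})\phi\rangle+C_n\rho^{-n}\langle\phi,N\phi\rangle .$$ In particular (take $B=b$), for every fixed $b>0$ both bounds hold for all $t>0$ and $\rho>b+ct$ with a constant $C_n$ that does not depend on $t$, $\rho$ or $\phi$. -/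

import Mathlib

open scoped ENNReal

namespace BoseHubbard

noncomputable section

/-! ### Creation and annihilation operators on sequences of `n`-particle wave functions -/

/-- Sequences `(ψ₀, ψ₁, ψ₂, …)` of complex functions `ψ n` of `n` points of `S`. -/
abbrev Wave (S : Type*) := (n : ℕ) → (Fin n → S) → ℂ

/-- The annihilation operator at the site `x`:
`(b_x ψ)_n (x₁, …, x_n) = √(n + 1) ψ_{n + 1} (x, x₁, …, x_n)`. -/
def annih {S : Type*} (x : S) (ψ : Wave S) : Wave S :=
  fun n v => ((√((n : ℝ) + 1) : ℝ) : ℂ) * ψ (n + 1) (Fin.cons x v)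

open Classical in
/-- The creation operator at the site `x`:
`(b*_x ψ)_n (x₁, …, x_n) = n^{-1/2} ∑ᵢ δ_{x, xᵢ} ψ_{n - 1} (x₁, …, x̂ᵢ, …, x_n)`, and
`(b*_x ψ)_0 = 0`. -/
def create {S : Type*} (x : S) (ψ : Wave S) : Wave S
  | 0, _ => 0
  | n + 1, v => (((√((n : ℝ) + 1))⁻¹ : ℝ) : ℂ) *
      ∑ i : Fin (n + 1), if v i = x then ψ n (i.removeNth v) else 0

/-- The number operator `n_x = b*_x b_x` at the site `x`. -/
def num {S : Type*} (x : S) (ψ : Wave S) : Wave S := create x (annih x ψ)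

/-- The expression
`H ψ = - ∑_{x, y ∈ Λ} J_{xy} b*_x b_y ψ + (g / 2) ∑_{x ∈ Λ} n_x (n_x - 1) ψ - μ ∑_{x ∈ Λ} n_x ψ`,
evaluated at each configuration of particles. At a given configuration only the finitely many
occupied sites `x` contribute. -/
def hamExpr {S : Type*} (Λ : Set S) (J : Λ → Λ → ℂ) (g μ : ℝ) (ψ : Wave S) : Wave S :=
  fun n v =>
    -(∑' x : Λ, ∑' y : Λ, J x y * create (x : S) (annih (y : S) ψ) n v)
      + ((g / 2 : ℝ) : ℂ) * (∑' x : Λ, (num (x : S) (num (x : S) ψ) n v - num (x : S) ψ n v))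
      - (μ : ℂ) * (∑' x : Λ, num (x : S) ψ n v)

/-! ### The bosonic Fock space over `ℓ²(S)` -/

/-- The symmetric functions in `ℓ²(Sⁿ)`. -/
def symmFun (S : Type*) (n : ℕ) : Submodule ℂ (lp (fun _ : Fin n → S => ℂ) 2) where
  carrier := {φ | ∀ (σ : Equiv.Perm (Fin n)) (v : Fin n → S), φ (v ∘ σ) = φ v}
  add_mem' := by
    intro a b ha hb σ v
    simp only [lp.coeFn_add, Pi.add_apply, ha σ v, hb σ v]
  zero_mem' := by
    intro σ v
    simp
  smul_mem' := by
    intro c a ha σ v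
    simp only [lp.coeFn_smul, Pi.smul_apply, ha σ v]

theorem isClosed_symmFun (S : Type*) (n : ℕ) :
    IsClosed (symmFun S n : Set (lp (fun _ : Fin n → S => ℂ) 2)) := by
  have hc : ∀ v : Fin n → S, Continuous fun φ : lp (fun _ : Fin n → S => ℂ) 2 => φ v :=
    fun v => (lp.lipschitzWith_one_eval (E := fun _ : Fin n → S => ℂ) 2 v).continuous
  have h : (symmFun S n : Set (lp (fun _ : Fin n → S => ℂ) 2)) =
      ⋂ (σ : Equiv.Perm (Fin n)) (v : Fin n → S), {φ | φ (v ∘ σ) = φ v} := by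
    ext φ
    simp only [Set.mem_iInter]
    rfl
  rw [h]
  exact isClosed_iInter fun σ => isClosed_iInter fun v => isClosed_eq (hc _) (hc _)

/-- The `n`-particle space, the `n`-fold symmetric tensor power of `ℓ²(S)`: the Hilbert space of
symmetric functions in `ℓ²(Sⁿ)`. -/
def Sector (S : Type*) (n : ℕ) : Type _ := symmFun S n

instance (S : Type*) (n : ℕ) : NormedAddCommGroup (Sector S n) :=
  inferInstanceAs (NormedAddCommGroup (symmFun S n))

instance (S : Type*) (n : ℕ) : InnerProductSpace ℂ (Sector S n) :=
  inferInstanceAs (InnerProductSpace ℂ (symmFun S n))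

instance (S : Type*) (n : ℕ) : CompleteSpace (Sector S n) :=
  (isClosed_symmFun S n).completeSpace_coe

/-- The function of `n` points that an `n`-particle vector is. -/
def Sector.toFun {S : Type*} {n : ℕ} (φ : Sector S n) (v : Fin n → S) : ℂ :=
  (show symmFun S n from φ).1 v

/-- The bosonic Fock space over `ℓ²(S)`: the Hilbert space direct sum of all `n`-particle
spaces. -/
abbrev Fock (S : Type*) := lp (fun n : ℕ => Sector S n) 2

/-- The wave functions of a vector of the Fock space. -/
def fockWave {S : Type*} (φ : Fock S) : Wave S := fun n => (φ n).toFun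

/-- The wave functions of an `n`-particle vector: zero in all sectors other than the `n`-th. -/
def sectorWave {S : Type*} {n : ℕ} (φ : Sector S n) : Wave S := Pi.single n φ.toFun

/-! ### The Hamiltonian and the time evolution -/

open Classical in
/-- The restriction `H_n` of the Hamiltonian to the `n`-particle space: the bounded self-adjoint
operator given by the expression for `H`. It exists as soon as `J` is Hermitian with uniformly
bounded row sums (`sectorHam_apply` below), and it is then unique. -/
def sectorHam {S : Type*} (Λ : Set S) (J : Λ → Λ → ℂ) (g μ : ℝ) (n : ℕ) :
    Sector S n →L[ℂ] Sector S n :=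
  if h : ∃ A : Sector S n →L[ℂ] Sector S n, IsSelfAdjoint A ∧
      ∀ (φ : Sector S n) (v : Fin n → S),
        (A φ).toFun v = hamExpr Λ J g μ (sectorWave φ) n v
  then h.choose else 0

theorem isSelfAdjoint_sectorHam {S : Type*} (Λ : Set S) (J : Λ → Λ → ℂ) (g μ : ℝ) (n : ℕ) :
    IsSelfAdjoint (sectorHam Λ J g μ n) := by
  unfold sectorHam
  split_ifs with h
  · exact h.choose_spec.1
  · exact IsSelfAdjoint.zero (Sector S n →L[ℂ] Sector S n)

/-- The operator `exp (-i t H_n)` on the `n`-particle space (exponential of a bounded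
operator). -/
def sectorEvol {S : Type*} (Λ : Set S) (J : Λ → Λ → ℂ) (g μ t : ℝ) (n : ℕ) :
    Sector S n →L[ℂ] Sector S n :=
  NormedSpace.exp ((-(Complex.I * (t : ℂ))) • sectorHam Λ J g μ n)

theorem exp_mem_unitary {R : Type*} [NormedRing R] [NormedAlgebra ℂ R] [StarRing R]
    [ContinuousStar R] [CompleteSpace R] [StarModule ℂ R] {a : R} (ha : IsSelfAdjoint a)
    (t : ℝ) : NormedSpace.exp ((-(Complex.I * (t : ℂ))) • a) ∈ unitary R := by
  let +nondep : NormedAlgebra ℚ R := .restrictScalars ℚ ℂ R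
  apply NormedSpace.exp_mem_unitary_of_mem_skewAdjoint
  rw [skewAdjoint.mem_iff, star_smul, ha.star_eq, ← neg_smul]
  simp

theorem norm_sectorEvol {S : Type*} (Λ : Set S) (J : Λ → Λ → ℂ) (g μ t : ℝ) (n : ℕ)
    (φ : Sector S n) : ‖sectorEvol Λ J g μ t n φ‖ = ‖φ‖ :=
  ContinuousLinearMap.norm_map_of_mem_unitary
    (exp_mem_unitary (isSelfAdjoint_sectorHam Λ J g μ n) t) φ

/-- The unitary evolution `exp (-i t H)` on the Fock space, where `H` is the direct sum of the
operators `H_n`. -/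
def evol {S : Type*} (Λ : Set S) (J : Λ → Λ → ℂ) (g μ t : ℝ) (φ : Fock S) : Fock S :=
  ⟨fun n => sectorEvol Λ J g μ t n (φ n), by
    have h := (lp.memℓp φ).summable (by norm_num)
    refine memℓp_gen ?_
    simpa only [norm_sectorEvol] using h⟩

/-! ### Particle numbers -/

/-- The quadratic form `⟨φ, dΓ(χ_A) φ⟩ = ∑_{x ∈ A} ⟨φ, b*_x b_x φ⟩ = ∑_{x ∈ A} ‖b_x φ‖²`, the
expected number of particles in the set of sites `A`; it takes the value `∞` outside of its form
domain. -/
def particles {S : Type*} (A : Set S) (φ : Fock S) : ℝ≥0∞ :=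
  ∑' x : A, ∑' n : ℕ, ∑' v : Fin n → S, ‖annih (x : S) (fockWave φ) n v‖ₑ ^ 2

/-- `φ ∈ D(N^{1/2})` for the number operator `N = ∑_{x ∈ Λ} n_x`. -/
def MemDomSqrtN {S : Type*} (Λ : Set S) (φ : Fock S) : Prop := particles Λ φ < ∞

/-- `κ_J^{(p)} = sup_{x ∈ Λ} ∑_{y ∈ Λ} |J_{xy}| |x - y|^p`, with values in `[0, ∞]`. -/
def kappa {S : Type*} [PseudoEMetricSpace S] (Λ : Set S) (J : Λ → Λ → ℂ) (p : ℕ) : ℝ≥0∞ :=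
  ⨆ x : Λ, ∑' y : Λ, ‖J x y‖ₑ * edist (x : S) (y : S) ^ p

/-! ### Well-definedness of `H_n`: for Hermitian `J` with bounded row sums, `sectorHam` is given
by the expression for `H` -/

/-- A Hermitian kernel with uniformly bounded absolute row sums defines a bounded self-adjoint
operator (Schur test). -/
theorem exists_schur {I : Type*} (M : I → I → ℂ) (hM : ∀ v w, M w v = star (M v w)) (C : ℝ)
    (hs : ∀ v, Summable fun w => ‖M v w‖) (hC : ∀ v, ∑' w, ‖M v w‖ ≤ C) :
    ∃ A : lp (fun _ : I => ℂ) 2 →L[ℂ] lp (fun _ : I => ℂ) 2, IsSelfAdjoint A ∧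
      ∀ f v, A f v = ∑' w, M v w * f w := by
  classical
  have hb : ∀ (f : lp (fun _ : I => ℂ) 2) w, ‖f w‖ ≤ ‖f‖ :=
    fun f w => lp.norm_apply_le_norm (by norm_num) f w
  have hsum : ∀ (f : lp (fun _ : I => ℂ) 2) v, Summable fun w => ‖M v w‖ * ‖f w‖ := fun f v =>
    Summable.of_nonneg_of_le (fun w => by positivity)
      (fun w => mul_le_mul_of_nonneg_left (hb f w) (norm_nonneg _)) ((hs v).mul_right ‖f‖)
  have hsum2 : ∀ (f : lp (fun _ : I => ℂ) 2) v, Summable fun w => ‖M v w‖ * ‖f w‖ ^ 2 :=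
    fun f v => Summable.of_nonneg_of_le (fun w => by positivity)
      (fun w => mul_le_mul_of_nonneg_left (pow_le_pow_left₀ (norm_nonneg _) (hb f w) 2)
        (norm_nonneg _)) ((hs v).mul_right (‖f‖ ^ 2))
  have hsumc : ∀ (f : lp (fun _ : I => ℂ) 2) v, Summable fun w => M v w * f w := fun f v =>
    Summable.of_norm (by simpa only [norm_mul] using hsum f v)
  have hsq : ∀ f : lp (fun _ : I => ℂ) 2, HasSum (fun w => ‖f w‖ ^ 2) (‖f‖ ^ 2) := by
    intro f
    have := lp.hasSum_norm (p := 2) (by norm_num) f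
    simpa using this
  have hcol : ∀ (s : Finset I) w, ∑ v ∈ s, ‖M v w‖ ≤ C := by
    intro s w
    have h1 : ∀ v, ‖M v w‖ = ‖M w v‖ := fun v => by rw [hM v w, norm_star]
    simp only [h1]
    exact ((hs w).sum_le_tsum s (fun _ _ => norm_nonneg _)).trans (hC w)
  have hpt : ∀ (f : lp (fun _ : I => ℂ) 2) v,
      ‖∑' w, M v w * f w‖ ^ 2 ≤ C * ∑' w, ‖M v w‖ * ‖f w‖ ^ 2 := by
    intro f v
    have hC0 : 0 ≤ C := (tsum_nonneg fun _ => norm_nonneg _).trans (hC v)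
    set X := ∑' w, ‖M v w‖ * ‖f w‖ with hX
    set Y := ∑' w, ‖M v w‖ * ‖f w‖ ^ 2 with hY
    have hY0 : 0 ≤ Y := tsum_nonneg fun _ => by positivity
    have hX0 : 0 ≤ X := tsum_nonneg fun _ => by positivity
    have h1 : ‖∑' w, M v w * f w‖ ≤ X := by
      refine (norm_tsum_le_tsum_norm (by simpa only [norm_mul] using hsum f v)).trans ?_
      simp only [norm_mul]; rfl
    have h2 : ∀ s : ℝ, 2 * s * X ≤ s ^ 2 * C + Y := by
      intro s
      have h3 : 2 * s * X ≤ s ^ 2 * (∑' w, ‖M v w‖) + Y := by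
        rw [hX, hY, ← tsum_mul_left, ← tsum_mul_left,
          ← ((hs v).mul_left _).tsum_add (hsum2 f v)]
        refine ((hsum f v).mul_left _).tsum_le_tsum (fun w => ?_)
          (((hs v).mul_left _).add (hsum2 f v))
        nlinarith [mul_nonneg (norm_nonneg (M v w)) (sq_nonneg (s - ‖f w‖))]
      nlinarith [mul_le_mul_of_nonneg_left (hC v) (sq_nonneg s)]
    have h4 : X ^ 2 ≤ C * Y := by
      rcases hC0.eq_or_lt with h | h
      · have := h2 (Y + 1)
        have h5 := h2 X
        rw [← h] at h5 this ⊢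
        by_contra hcon
        have hXp : 0 < X := by
          rcases hX0.eq_or_lt with h6 | h6
          · exfalso; apply hcon; rw [← h6]; simp
          · exact h6
        have := h2 ((Y + 1) / X)
        rw [← h] at this
        have h7 : 2 * ((Y + 1) / X) * X = 2 * (Y + 1) := by field_simp
        rw [h7] at this
        linarith
      · have := h2 (X / C)
        have h7 : 2 * (X / C) * X = 2 * X ^ 2 / C := by field_simp
        have h8 : (X / C) ^ 2 * C = X ^ 2 / C := by field_simp
        rw [h7, h8] at this
        have h9 : X ^ 2 / C ≤ Y := by
          have : 2 * X ^ 2 / C = X ^ 2 / C + X ^ 2 / C := by ring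
          linarith
        rw [div_le_iff₀ h] at h9
        linarith
    exact (pow_le_pow_left₀ (norm_nonneg _) h1 2).trans h4
  have hfin : ∀ (f : lp (fun _ : I => ℂ) 2) (s : Finset I),
      ∑ v ∈ s, ‖∑' w, M v w * f w‖ ^ 2 ≤ C * (C * ‖f‖ ^ 2) := by
    intro f s
    rcases s.eq_empty_or_nonempty with rfl | ⟨v₀, -⟩
    · simp only [Finset.sum_empty]
      rcases isEmpty_or_nonempty I with h | ⟨⟨v₀⟩⟩
      · have : f = 0 := lp.eq_zero' f
        simp [this]
      · have hC0 : 0 ≤ C := (tsum_nonneg fun _ => norm_nonneg _).trans (hC v₀)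
        positivity
    have hC0 : 0 ≤ C := (tsum_nonneg fun _ => norm_nonneg _).trans (hC v₀)
    refine (Finset.sum_le_sum fun v _ => hpt f v).trans ?_
    rw [← Finset.mul_sum]
    refine mul_le_mul_of_nonneg_left ?_ hC0
    rw [← Summable.tsum_finsetSum fun v _ => hsum2 f v, ← (hsq f).tsum_eq, ← tsum_mul_left]
    refine Summable.tsum_le_tsum (fun w => ?_) (summable_sum fun v _ => hsum2 f v)
      ((hsq f).summable.mul_left _)
    rw [← Finset.sum_mul]
    exact mul_le_mul_of_nonneg_right (hcol s w) (by positivity)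
  have hmem : ∀ f : lp (fun _ : I => ℂ) 2,
      Memℓp (fun v => (∑' w, M v w * f w : ℂ)) 2 := fun f =>
    memℓp_gen' (C := C * (C * ‖f‖ ^ 2)) fun s => by simpa using hfin f s
  let T : lp (fun _ : I => ℂ) 2 →ₗ[ℂ] lp (fun _ : I => ℂ) 2 :=
    { toFun := fun f => ⟨fun v => ∑' w, M v w * f w, hmem f⟩
      map_add' := by
        intro f g
        ext v
        simp only [lp.coeFn_add, Pi.add_apply, mul_add]
        exact (hsumc f v).tsum_add (hsumc g v)
      map_smul' := by
        intro c f
        ext v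
        simp only [lp.coeFn_smul, Pi.smul_apply, smul_eq_mul, RingHom.id_apply]
        rw [← tsum_mul_left]
        exact tsum_congr fun w => by ring }
  let A : lp (fun _ : I => ℂ) 2 →L[ℂ] lp (fun _ : I => ℂ) 2 :=
    T.mkContinuous |C| fun f => by
      refine lp.norm_le_of_forall_sum_le (by norm_num) (by positivity) fun s => ?_
      have := hfin f s
      have h2 : (|C| * ‖f‖) ^ 2 = C * (C * ‖f‖ ^ 2) := by rw [mul_pow, sq_abs]; ring
      rw [← h2] at this
      simpa [T] using this
  have hA : ∀ f v, A f v = ∑' w, M v w * f w := fun f v => rfl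
  refine ⟨A, ?_, hA⟩
  have hsingle : ∀ w a v, A (lp.single 2 w a) v = M v w * a := by
    intro w a v
    rw [hA, tsum_eq_single w, lp.single_apply_self]
    intro u hu
    rw [lp.single_apply_ne _ _ _ hu, mul_zero]
  show star A = A
  rw [ContinuousLinearMap.star_eq_adjoint]
  refine lp.ext_continuousLinearMap (by norm_num) fun w => ?_
  ext v
  simp only [ContinuousLinearMap.comp_apply, lp.singleContinuousLinearMap_apply]
  rw [hsingle]
  have h := lp.inner_single_left (𝕜 := ℂ) (G := fun _ : I => ℂ) v 1
    (ContinuousLinearMap.adjoint A (lp.single 2 w 1))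
  rw [ContinuousLinearMap.adjoint_inner_right, lp.inner_single_right, hsingle, hM v w] at h
  simpa [mul_comm] using h.symm

theorem create_annih {S : Type*} [DecidableEq S] (x y : S) (ψ : Wave S) (n : ℕ)
    (hψ : ∀ (σ : Equiv.Perm (Fin n)) (v : Fin n → S), ψ n (v ∘ σ) = ψ n v) (v : Fin n → S) :
    create x (annih y ψ) n v = ∑ i, if v i = x then ψ n (Function.update v i y) else 0 := by
  cases n with
  | zero => simp [create]
  | succ m =>
    have h0 : ((√((m : ℝ) + 1) : ℝ) : ℂ) ≠ 0 := by
      rw [Complex.ofReal_ne_zero]; positivity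
    have h1 : ∀ i : Fin (m + 1), ψ (m + 1) (Fin.cons y (i.removeNth v)) =
        ψ (m + 1) (Function.update v i y) := by
      intro i
      rw [← hψ i.cycleRange, Fin.cons_comp_cycleRange, Fin.insertNth_removeNth]
    simp only [create, annih, h1, Finset.mul_sum]
    refine Finset.sum_congr rfl fun i _ => ?_
    by_cases h : v i = x
    · simp only [h, if_true, Complex.ofReal_inv]
      rw [← mul_assoc, inv_mul_cancel₀ h0, one_mul]
    · simp [h]

theorem num_eq {S : Type*} [DecidableEq S] (x : S) (ψ : Wave S) (n : ℕ)
    (hψ : ∀ (σ : Equiv.Perm (Fin n)) (v : Fin n → S), ψ n (v ∘ σ) = ψ n v) (v : Fin n → S) :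
    num x ψ n v = (∑ i, if v i = x then (1 : ℂ) else 0) * ψ n v := by
  rw [num, create_annih x x ψ n hψ, Finset.sum_mul]
  refine Finset.sum_congr rfl fun i _ => ?_
  by_cases h : v i = x
  · simp [← h]
  · simp [h]

theorem sum_comp_perm {S : Type*} [DecidableEq S] (x : S) {n : ℕ} (σ : Equiv.Perm (Fin n))
    (v : Fin n → S) : (∑ i, if (v ∘ σ) i = x then (1 : ℂ) else 0) =
      ∑ i, if v i = x then (1 : ℂ) else 0 :=
  Equiv.sum_comp σ fun i => if v i = x then (1 : ℂ) else 0

theorem num_num_eq {S : Type*} [DecidableEq S] (x : S) (ψ : Wave S) (n : ℕ)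
    (hψ : ∀ (σ : Equiv.Perm (Fin n)) (v : Fin n → S), ψ n (v ∘ σ) = ψ n v) (v : Fin n → S) :
    num x (num x ψ) n v = (∑ i, if v i = x then (1 : ℂ) else 0) ^ 2 * ψ n v := by
  rw [num_eq x (num x ψ) n, num_eq x ψ n hψ, sq, mul_assoc]
  intro σ w
  rw [num_eq x ψ n hψ, num_eq x ψ n hψ, hψ, sum_comp_perm]

open Classical in
/-- The part of the kernel in which the `i`-th particle hops. -/
def hop {S : Type*} (Λ : Set S) (J : Λ → Λ → ℂ) (n : ℕ) (i : Fin n) (v w : Fin n → S) : ℂ :=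
  if h : v i ∈ Λ ∧ w i ∈ Λ ∧ w = Function.update v i (w i) then
    J ⟨v i, h.1⟩ ⟨w i, h.2.1⟩ else 0

open Classical in
/-- The diagonal part of the kernel. -/
def diag {S : Type*} (Λ : Set S) (g μ : ℝ) (n : ℕ) (v : Fin n → S) : ℝ :=
  g / 2 * (∑ i, ∑ j, if v i ∈ Λ ∧ v i = v j then (1 : ℝ) else 0)
    - (g / 2 + μ) * ∑ i, if v i ∈ Λ then (1 : ℝ) else 0

open Classical in
/-- The integral kernel of `H_n`. -/
def kernel {S : Type*} (Λ : Set S) (J : Λ → Λ → ℂ) (g μ : ℝ) (n : ℕ) (v w : Fin n → S) : ℂ :=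
  (if w = v then (diag Λ g μ n v : ℂ) else 0) - ∑ i, hop Λ J n i v w

theorem hop_star {S : Type*} (Λ : Set S) (J : Λ → Λ → ℂ) (hJ : ∀ x y, J y x = star (J x y))
    (n : ℕ) (i : Fin n) (v w : Fin n → S) : hop Λ J n i w v = star (hop Λ J n i v w) := by
  unfold hop
  have hiff : (w i ∈ Λ ∧ v i ∈ Λ ∧ v = Function.update w i (v i)) ↔
      (v i ∈ Λ ∧ w i ∈ Λ ∧ w = Function.update v i (w i)) := by
    constructor
    · rintro ⟨h1, h2, h3⟩
      exact ⟨h2, h1, by rw [h3]; simp⟩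
    · rintro ⟨h1, h2, h3⟩
      exact ⟨h2, h1, by rw [h3]; simp⟩
  by_cases h : v i ∈ Λ ∧ w i ∈ Λ ∧ w = Function.update v i (w i)
  · rw [dif_pos h, dif_pos (hiff.2 h), hJ]
  · rw [dif_neg h, dif_neg (fun h' => h (hiff.1 h')), star_zero]

theorem kernel_star {S : Type*} (Λ : Set S) (J : Λ → Λ → ℂ) (hJ : ∀ x y, J y x = star (J x y))
    (g μ : ℝ) (n : ℕ) (v w : Fin n → S) :
    kernel Λ J g μ n w v = star (kernel Λ J g μ n v w) := by
  unfold kernel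
  rw [star_sub, star_sum]
  congr 1
  · by_cases h : w = v
    · subst h; simp
    · rw [if_neg h, if_neg (Ne.symm h), star_zero]
  · exact Finset.sum_congr rfl fun i _ => hop_star Λ J hJ n i v w

theorem hop_perm {S : Type*} (Λ : Set S) (J : Λ → Λ → ℂ) (n : ℕ) (i : Fin n)
    (σ : Equiv.Perm (Fin n)) (v w : Fin n → S) :
    hop Λ J n i (v ∘ σ) (w ∘ σ) = hop Λ J n (σ i) v w := by
  have hiff : w ∘ σ = Function.update (v ∘ σ) i (w (σ i)) ↔
      w = Function.update v (σ i) (w (σ i)) := by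
    have h1 : Function.update (v ∘ σ) i (w (σ i)) =
        Function.update v (σ i) (w (σ i)) ∘ σ := by
      rw [Function.update_comp_eq_of_injective v σ.injective]
    rw [h1]
    exact σ.surjective.injective_comp_right.eq_iff
  unfold hop
  by_cases h : v (σ i) ∈ Λ ∧ w (σ i) ∈ Λ ∧ w = Function.update v (σ i) (w (σ i))
  · rw [dif_pos h, dif_pos ⟨h.1, h.2.1, hiff.2 h.2.2⟩]
    rfl
  · rw [dif_neg h, dif_neg fun h' => h ⟨h'.1, h'.2.1, hiff.1 h'.2.2⟩]

theorem kernel_perm {S : Type*} (Λ : Set S) (J : Λ → Λ → ℂ) (g μ : ℝ) (n : ℕ)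
    (σ : Equiv.Perm (Fin n)) (v w : Fin n → S) :
    kernel Λ J g μ n (v ∘ σ) (w ∘ σ) = kernel Λ J g μ n v w := by
  classical
  unfold kernel
  have h1 : diag Λ g μ n (v ∘ σ) = diag Λ g μ n v := by
    unfold diag
    simp only [Function.comp_apply]
    rw [Equiv.sum_comp σ (fun i => ∑ j, if v i ∈ Λ ∧ v i = v (σ j) then (1 : ℝ) else 0),
      Equiv.sum_comp σ (fun i => if v i ∈ Λ then (1 : ℝ) else 0)]
    congr 2
    exact Finset.sum_congr rfl fun i _ =>
      Equiv.sum_comp σ (fun j => if v i ∈ Λ ∧ v i = v j then (1 : ℝ) else 0)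
  simp only [h1, hop_perm, σ.surjective.injective_comp_right.eq_iff]
  rw [Equiv.sum_comp σ fun i => hop Λ J n i v w]

theorem hasSum_hop {S : Type*} {E : Type*} [AddCommMonoid E] [TopologicalSpace E] [DecidableEq S]
    (Λ : Set S) (J : Λ → Λ → ℂ) (n : ℕ) (i : Fin n) (v : Fin n → S)
    (F : ℂ → (Fin n → S) → E) (hF : ∀ w, F 0 w = 0) (h : v i ∈ Λ) {a : E}
    (ha : HasSum (fun y : Λ => F (J ⟨v i, h⟩ y) (Function.update v i y)) a) :
    HasSum (fun w => F (hop Λ J n i v w) w) a := by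
  have hinj : Function.Injective fun y : Λ => Function.update v i (y : S) := fun y z hyz =>
    Subtype.ext (Function.update_injective v i hyz)
  refine (hinj.hasSum_iff ?_).1 ?_
  · intro w hw
    rw [hop, dif_neg, hF]
    rintro ⟨_, h2, h3⟩
    exact hw ⟨⟨w i, h2⟩, h3.symm⟩
  · convert ha using 2 with y
    have : hop Λ J n i v (Function.update v i (y : S)) = J ⟨v i, h⟩ y := by
      rw [hop, dif_pos ⟨h, by simp, by simp⟩]
      congr 1
      simp
    simp only [Function.comp_apply, this]

theorem summable_norm_hop {S : Type*} (Λ : Set S) (J : Λ → Λ → ℂ) (B : ℝ)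
    (hs : ∀ x, Summable fun y => ‖J x y‖) (hB : ∀ x, ∑' y, ‖J x y‖ ≤ B)
    (n : ℕ) (i : Fin n) (v : Fin n → S) :
    (Summable fun w => ‖hop Λ J n i v w‖) ∧ ∑' w, ‖hop Λ J n i v w‖ ≤ |B| := by
  classical
  by_cases h : v i ∈ Λ
  · have := hasSum_hop Λ J n i v (fun z _ => ‖z‖) (fun _ => norm_zero) h (hs ⟨v i, h⟩).hasSum
    exact ⟨this.summable, by rw [this.tsum_eq]; exact (hB _).trans (le_abs_self B)⟩
  · have : ∀ w, hop Λ J n i v w = 0 := fun w => dif_neg fun h' => h h'.1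
    simp only [this, norm_zero]
    exact ⟨summable_zero, by simp⟩

theorem abs_diag_le {S : Type*} (Λ : Set S) (g μ : ℝ) (n : ℕ) (v : Fin n → S) :
    |diag Λ g μ n v| ≤ |g / 2| * (n * n) + |g / 2 + μ| * n := by
  classical
  have h1 : |∑ i, ∑ j, if v i ∈ Λ ∧ v i = v j then (1 : ℝ) else 0| ≤ n * n := by
    rw [abs_of_nonneg (by positivity)]
    refine (Finset.sum_le_sum fun i _ => Finset.sum_le_sum fun j _ =>
      (ite_le_one le_rfl zero_le_one)).trans ?_
    simp
  have h2 : |∑ i, if v i ∈ Λ then (1 : ℝ) else 0| ≤ n := by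
    rw [abs_of_nonneg (by positivity)]
    refine (Finset.sum_le_sum fun i _ => (ite_le_one le_rfl zero_le_one)).trans ?_
    simp
  unfold diag
  refine (abs_sub _ _).trans ?_
  rw [abs_mul, abs_mul]
  gcongr

theorem summable_norm_kernel {S : Type*} (Λ : Set S) (J : Λ → Λ → ℂ) (B : ℝ)
    (hs : ∀ x, Summable fun y => ‖J x y‖) (hB : ∀ x, ∑' y, ‖J x y‖ ≤ B)
    (g μ : ℝ) (n : ℕ) (v : Fin n → S) :
    (Summable fun w => ‖kernel Λ J g μ n v w‖) ∧
      ∑' w, ‖kernel Λ J g μ n v w‖ ≤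
        |g / 2| * (n * n) + |g / 2 + μ| * n + n * |B| := by
  classical
  have h1 : HasSum (fun w => ‖if w = v then (diag Λ g μ n v : ℂ) else 0‖) |diag Λ g μ n v| := by
    convert hasSum_ite_eq v |diag Λ g μ n v| using 2 with w
    by_cases h : w = v <;> simp [h]
  have h2 := fun i => summable_norm_hop Λ J B hs hB n i v
  have h3 : Summable fun w => ∑ i, ‖hop Λ J n i v w‖ := summable_sum fun i _ => (h2 i).1
  have hle : ∀ w, ‖kernel Λ J g μ n v w‖ ≤
      ‖if w = v then (diag Λ g μ n v : ℂ) else 0‖ + ∑ i, ‖hop Λ J n i v w‖ := fun w =>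
    (norm_sub_le _ _).trans (add_le_add_right (norm_sum_le _ _) _)
  have hsum : Summable fun w => ‖kernel Λ J g μ n v w‖ :=
    Summable.of_nonneg_of_le (fun _ => norm_nonneg _) hle (h1.summable.add h3)
  refine ⟨hsum, (hsum.tsum_le_tsum hle (h1.summable.add h3)).trans ?_⟩
  rw [h1.summable.tsum_add h3, h1.tsum_eq, Summable.tsum_finsetSum fun i _ => (h2 i).1]
  refine add_le_add (abs_diag_le Λ g μ n v) ?_
  refine (Finset.sum_le_sum fun i _ => (h2 i).2).trans ?_
  simp

theorem hamExpr_eq {S : Type*} (Λ : Set S) (J : Λ → Λ → ℂ)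
    (hs : ∀ x, Summable fun y => ‖J x y‖) (g μ : ℝ) (n : ℕ) (ψ : Wave S)
    (hψ : ∀ (σ : Equiv.Perm (Fin n)) (v : Fin n → S), ψ n (v ∘ σ) = ψ n v)
    (K : ℝ) (hK : ∀ v, ‖ψ n v‖ ≤ K) (v : Fin n → S) :
    hamExpr Λ J g μ ψ n v = ∑' w, kernel Λ J g μ n v w * ψ n w := by
  classical
  have hsJ : ∀ x i, Summable fun y : Λ => J x y * ψ n (Function.update v i y) := by
    intro x i
    refine Summable.of_norm_bounded ((hs x).mul_right K) fun y => ?_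
    rw [norm_mul]
    exact mul_le_mul_of_nonneg_left (hK _) (norm_nonneg _)
  -- the hopping part
  let a : Fin n → ℂ := fun i =>
    if h : v i ∈ Λ then ∑' y : Λ, J ⟨v i, h⟩ y * ψ n (Function.update v i y) else 0
  have ha : ∀ i, HasSum (fun w => hop Λ J n i v w * ψ n w) (a i) := by
    intro i
    by_cases h : v i ∈ Λ
    · simp only [a, dif_pos h]
      exact hasSum_hop Λ J n i v (fun z w => z * ψ n w) (fun w => zero_mul _) h
        (hsJ ⟨v i, h⟩ i).hasSum
    · have : ∀ w, hop Λ J n i v w = 0 := fun w => dif_neg fun h' => h h'.1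
      simp only [a, dif_neg h, this, zero_mul]
      exact hasSum_zero
  have hRHS : HasSum (fun w => kernel Λ J g μ n v w * ψ n w)
      ((diag Λ g μ n v : ℂ) * ψ n v - ∑ i, a i) := by
    have h1 : HasSum (fun w => (if w = v then (diag Λ g μ n v : ℂ) else 0) * ψ n w)
        ((diag Λ g μ n v : ℂ) * ψ n v) := by
      convert hasSum_ite_eq v ((diag Λ g μ n v : ℂ) * ψ n v) using 2 with w
      by_cases h : w = v
      · simp [h]
      · simp [h]
    have := h1.sub (hasSum_sum fun i (_ : i ∈ Finset.univ) => ha i)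
    have h2 : (fun w => kernel Λ J g μ n v w * ψ n w) = fun w =>
        (if w = v then (diag Λ g μ n v : ℂ) else 0) * ψ n w -
          ∑ i, hop Λ J n i v w * ψ n w := by
      funext w
      rw [kernel, sub_mul, Finset.sum_mul]
    rw [h2]
    exact this
  rw [hRHS.tsum_eq]
  -- sums over occupied sites
  have hocc : ∀ (c : Fin n → Λ → ℂ),
      HasSum (fun x : Λ => ∑ i, if v i = (x : S) then c i x else 0)
        (∑ i, if h : v i ∈ Λ then c i ⟨v i, h⟩ else 0) := by
    intro c
    refine hasSum_sum fun i _ => ?_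
    by_cases h : v i ∈ Λ
    · rw [dif_pos h]
      convert hasSum_ite_eq (⟨v i, h⟩ : Λ) (c i ⟨v i, h⟩) using 2 with x
      by_cases hx : v i = x
      · have : x = ⟨v i, h⟩ := Subtype.ext hx.symm
        subst this
        simp
      · rw [if_neg hx, if_neg]
        intro hx'
        exact hx (by rw [hx'])
    · rw [dif_neg h]
      convert hasSum_zero (α := ℂ) (β := Λ) using 2 with x
      rw [if_neg]
      intro hx
      exact h (by rw [hx]; exact x.2)
  have hT : (∑' x : Λ, ∑' y : Λ, J x y * create (x : S) (annih (y : S) ψ) n v) = ∑ i, a i := by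
    refine Eq.trans (tsum_congr fun x => ?_)
      (hocc fun i x => ∑' y : Λ, J x y * ψ n (Function.update v i y)).tsum_eq
    have h1 : ∀ y : Λ, J x y * create (x : S) (annih (y : S) ψ) n v =
        ∑ i, if v i = x then J x y * ψ n (Function.update v i y) else 0 := by
      intro y
      rw [create_annih _ _ ψ n hψ, Finset.mul_sum]
      exact Finset.sum_congr rfl fun i _ => by split_ifs <;> simp
    simp only [h1]
    rw [Summable.tsum_finsetSum]
    · refine Finset.sum_congr rfl fun i _ => ?_
      split_ifs
      · rfl
      · simp
    · intro i _
      split_ifs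
      · exact hsJ x i
      · exact summable_zero
  have hN : HasSum (fun x : Λ => ∑ i, if v i = (x : S) then (1 : ℂ) else 0)
      (∑ i, if v i ∈ Λ then (1 : ℂ) else 0) := by
    convert hocc fun _ _ => 1 using 2
    split_ifs <;> rfl
  have hN2 : HasSum (fun x : Λ => (∑ i, if v i = (x : S) then (1 : ℂ) else 0) ^ 2)
      (∑ i, ∑ j, if v i ∈ Λ ∧ v i = v j then (1 : ℂ) else 0) := by
    convert hocc fun i x => ∑ j, if v j = (x : S) then (1 : ℂ) else 0 using 2 with x i
    · rw [sq, Finset.sum_mul]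
      exact Finset.sum_congr rfl fun i _ => by split_ifs <;> simp
    · by_cases h : v i ∈ Λ
      · simp [h, eq_comm]
      · simp [h]
  rw [hamExpr, hT]
  simp only [num_num_eq _ ψ n hψ, num_eq _ ψ n hψ]
  rw [((hN2.mul_right (ψ n v)).sub (hN.mul_right (ψ n v))).tsum_eq,
    (hN.mul_right (ψ n v)).tsum_eq, diag]
  push_cast
  simp only [apply_ite Complex.ofReal, Complex.ofReal_one, Complex.ofReal_zero]
  ring

/-- If `J` is Hermitian with bounded row sums, then `H_n` is given by the expression for `H`. -/
theorem sectorHam_apply {S : Type*} (Λ : Set S) (J : Λ → Λ → ℂ)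
    (hJ : ∀ x y, J y x = star (J x y)) (B : ℝ)
    (hs : ∀ x, Summable fun y => ‖J x y‖) (hB : ∀ x, ∑' y, ‖J x y‖ ≤ B)
    (g μ : ℝ) (n : ℕ) (φ : Sector S n) (v : Fin n → S) :
    (sectorHam Λ J g μ n φ).toFun v = hamExpr Λ J g μ (sectorWave φ) n v := by
  obtain ⟨A, hA, hAf⟩ := exists_schur (kernel Λ J g μ n) (kernel_star Λ J hJ g μ n) _
    (fun v => (summable_norm_kernel Λ J B hs hB g μ n v).1)
    (fun v => (summable_norm_kernel Λ J B hs hB g μ n v).2)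
  have hmaps : ∀ f ∈ symmFun S n, A f ∈ symmFun S n := by
    intro f hf σ v
    rw [hAf, hAf, ← (σ.symm.arrowCongr (Equiv.refl S)).tsum_eq]
    refine tsum_congr fun w => ?_
    have hw : (σ.symm.arrowCongr (Equiv.refl S)) w = w ∘ σ := by
      ext i; simp [Equiv.arrowCongr]
    rw [hw, kernel_perm, hf σ w]
  let A' : symmFun S n →L[ℂ] symmFun S n := A.restrict hmaps
  have hsym : A.IsSymmetric := ContinuousLinearMap.isSelfAdjoint_iff_isSymmetric.1 hA
  have hex : ∃ A : Sector S n →L[ℂ] Sector S n, IsSelfAdjoint A ∧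
      ∀ (φ : Sector S n) (v : Fin n → S),
        (A φ).toFun v = hamExpr Λ J g μ (sectorWave φ) n v := by
    refine ⟨(show Sector S n →L[ℂ] Sector S n from A'), ?_, ?_⟩
    · rw [ContinuousLinearMap.isSelfAdjoint_iff_isSymmetric]
      intro f h
      exact hsym (show symmFun S n from f).1 (show symmFun S n from h).1
    · intro φ v
      have h1 : sectorWave φ n = φ.toFun := 
        Pi.single_eq_same (M := fun n => (Fin n → S) → ℂ) n φ.toFun
      rw [hamExpr_eq Λ J hs g μ n (sectorWave φ) ?_ ‖φ‖ ?_ v, h1]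
      · exact hAf (show symmFun S n from φ).1 v
      · intro σ w
        rw [h1]
        exact (show symmFun S n from φ).2 σ w
      · intro w
        rw [h1]
        exact lp.norm_apply_le_norm (by norm_num) (show symmFun S n from φ).1 w
  unfold sectorHam
  rw [dif_pos hex]
  exact hex.choose_spec.2 φ v

end

end BoseHubbard

/-! The propagation observable is the second quantization of a smoothed indicator function
`profile q ((h x - c * t) / s)` of the sites ahead of a front that moves at a speed `c` larger than
the mean hopping speed `kappa Λ J 1`. Its expectation decreases in time. The interaction and the
chemical potential are functions of the particle positions and do not contribute, and hopping
transports mass across the front at a rate at most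
`∑' y, |profile q (h x / s) - profile q (h y / s)| * ‖J x y‖` per particle at `x`. As the derivative
of `profile q` decays like `|r| ^ (-(q + 1))`, its increments are bounded by
`profileDeriv q r * ((1 + ε) * |r - u| + K * |r - u| ^ (q + 1))`, so this rate is at most
`profileDeriv q (h x / s) / s` times `(1 + ε) * κ₁ + K * κ_{q + 1} / s ^ q`, which is less than `c`
once `s` is large. The tails of `profile q` are the error terms, and the two bounds are the cases
`h x = ‖x‖` and `h x = -‖x‖`. -/

namespace BoseHubbard

noncomputable section

/-! ### An increasing profile with polynomial tails -/

/-- The cutoff profile: an increasing function from `0` at `-∞` to `1` at `∞`, symmetric about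
`0`, with tails of order `|r| ^ (-q)`. -/
def profile (q : ℕ) (r : ℝ) : ℝ :=
  if r ≤ 0 then 2⁻¹ * ((1 - r) ^ q)⁻¹ else 1 - 2⁻¹ * ((1 + r) ^ q)⁻¹

/-- The derivative of `profile`. -/
def profileDeriv (q : ℕ) (r : ℝ) : ℝ := q / 2 * ((1 + |r|) ^ (q + 1))⁻¹

theorem profile_of_nonpos (q : ℕ) {r : ℝ} (hr : r ≤ 0) :
    profile q r = 2⁻¹ * ((1 - r) ^ q)⁻¹ := if_pos hr

theorem profile_of_nonneg (q : ℕ) {r : ℝ} (hr : 0 ≤ r) :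
    profile q r = 1 - 2⁻¹ * ((1 + r) ^ q)⁻¹ := by
  rcases hr.eq_or_lt with rfl | h
  · norm_num [profile]
  · exact if_neg h.not_ge

theorem profile_neg (q : ℕ) (r : ℝ) : profile q (-r) = 1 - profile q r := by
  rcases le_total r 0 with h | h
  · rw [profile_of_nonpos q h, profile_of_nonneg q (neg_nonneg.2 h), sub_eq_add_neg 1 r]
  · rw [profile_of_nonneg q h, profile_of_nonpos q (neg_nonpos.2 h)]
    ring_nf

theorem profile_nonneg (q : ℕ) (r : ℝ) : 0 ≤ profile q r := by
  rcases le_total r 0 with h | h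
  · rw [profile_of_nonpos q h]
    have : 0 ≤ 1 - r := by linarith
    positivity
  · rw [profile_of_nonneg q h]
    have : ((1 + r) ^ q)⁻¹ ≤ 1 := inv_le_one_of_one_le₀ (one_le_pow₀ (by linarith))
    linarith

theorem profile_le_one (q : ℕ) (r : ℝ) : profile q r ≤ 1 := by
  have := profile_nonneg q (-r)
  rw [profile_neg] at this
  linarith

theorem abs_profile_le_one (q : ℕ) (r : ℝ) : |profile q r| ≤ 1 :=
  abs_le.2 ⟨by linarith [profile_nonneg q r], profile_le_one q r⟩

theorem two_mul_profile_neg (q : ℕ) {r : ℝ} (hr : 0 ≤ r) :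
    2 * profile q (-r) = ((1 + r) ^ q)⁻¹ := by
  rw [profile_neg, profile_of_nonneg q hr]
  ring

theorem profileDeriv_nonneg (q : ℕ) (r : ℝ) : 0 ≤ profileDeriv q r := by
  unfold profileDeriv
  positivity

theorem profileDeriv_le (q : ℕ) (r : ℝ) : profileDeriv q r ≤ q / 2 := by
  have : ((1 + |r|) ^ (q + 1))⁻¹ ≤ 1 :=
    inv_le_one_of_one_le₀ (one_le_pow₀ (by linarith [abs_nonneg r]))
  exact mul_le_of_le_one_right (by positivity) this

theorem hasDerivAt_one_sub_inv_pow (q : ℕ) {r : ℝ} (hr : 0 ≤ r) :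
    HasDerivAt (fun u : ℝ => 1 - 2⁻¹ * ((1 + u) ^ q)⁻¹) (profileDeriv q r) r := by
  have h1 : 1 + r ≠ 0 := by positivity
  have h := ((((hasDerivAt_id r).const_add 1).pow q).inv (pow_ne_zero q h1)).const_mul (2⁻¹ : ℝ)
  refine (h.const_sub 1).congr_deriv ?_
  rw [profileDeriv, abs_of_nonneg hr]
  rcases q with _ | q
  · simp
  · simp only [id, mul_one, Pi.pow_apply, Nat.add_sub_cancel]
    field_simp
    ring

theorem hasDerivAt_profile (q : ℕ) (r : ℝ) : HasDerivAt (profile q) (profileDeriv q r) r := by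
  have right {r : ℝ} (hr : 0 ≤ r) :
      HasDerivWithinAt (profile q) (profileDeriv q r) (Set.Ici 0) r :=
    (hasDerivAt_one_sub_inv_pow q hr).hasDerivWithinAt.congr
      (fun u hu => profile_of_nonneg q hu) (profile_of_nonneg q hr)
  have left {r : ℝ} (hr : r ≤ 0) :
      HasDerivWithinAt (profile q) (profileDeriv q r) (Set.Iic 0) r := by
    have h := (hasDerivAt_one_sub_inv_pow q (neg_nonneg.2 hr)).scomp r (hasDerivAt_neg r)
    refine ((h.const_sub 1).congr_deriv (by simp [profileDeriv])).hasDerivWithinAt.congr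
      (fun u hu => ?_) ?_
    · simp [profile_of_nonpos q hu, sub_eq_add_neg]
    · simp [profile_of_nonpos q hr, sub_eq_add_neg]
  rcases lt_trichotomy r 0 with h | rfl | h
  · exact (left h.le).hasDerivAt (Iic_mem_nhds h)
  · have := (left le_rfl).union (right le_rfl)
    rwa [Set.Iic_union_Ici, hasDerivWithinAt_univ] at this
  · exact (right h.le).hasDerivAt (Ici_mem_nhds h)

theorem monotone_profile (q : ℕ) : Monotone (profile q) :=
  monotone_of_hasDerivAt_nonneg (hasDerivAt_profile q) (profileDeriv_nonneg q)

theorem abs_inv_one_add_abs_sub_le (r u : ℝ) : |(1 + |u|)⁻¹ - (1 + |r|)⁻¹| ≤ |u - r| := by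
  have hr : 1 ≤ 1 + |r| := by linarith [abs_nonneg r]
  have hu : 1 ≤ 1 + |u| := by linarith [abs_nonneg u]
  rw [inv_sub_inv (by positivity) (by positivity), abs_div,
    abs_of_pos (show 0 < (1 + |u|) * (1 + |r|) by positivity)]
  refine (div_le_self (abs_nonneg _) (one_le_mul_of_one_le_of_one_le hu hr)).trans ?_
  rw [add_sub_add_left_eq_sub, abs_sub_comm]
  exact abs_abs_sub_abs_le u r

theorem abs_profileDeriv_sub_le (q : ℕ) (r u : ℝ) :
    |profileDeriv q u - profileDeriv q r| ≤ q / 2 * (q + 1) * |u - r| := by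
  have habs_inv (x : ℝ) : |(1 + |x|)⁻¹| ≤ 1 := by
    rw [abs_of_pos (by positivity)]
    exact inv_le_one_of_one_le₀ (by linarith [abs_nonneg x])
  have hmax : max |(1 + |u|)⁻¹| |(1 + |r|)⁻¹| ^ q ≤ 1 :=
    pow_le_one₀ (by positivity) (max_le (habs_inv u) (habs_inv r))
  unfold profileDeriv
  rw [← mul_sub, abs_mul, abs_of_nonneg (by positivity : (0 : ℝ) ≤ q / 2), mul_assoc,
    ← inv_pow, ← inv_pow]
  refine mul_le_mul_of_nonneg_left ?_ (by positivity)
  calc |(1 + |u|)⁻¹ ^ (q + 1) - (1 + |r|)⁻¹ ^ (q + 1)|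
      ≤ |(1 + |u|)⁻¹ - (1 + |r|)⁻¹| * (q + 1 : ℕ) * max |(1 + |u|)⁻¹| |(1 + |r|)⁻¹| ^ q :=
        abs_pow_sub_pow_le _ _ (q + 1)
    _ ≤ |u - r| * (q + 1 : ℕ) * 1 :=
        mul_le_mul (mul_le_mul_of_nonneg_right (abs_inv_one_add_abs_sub_le r u) (by positivity))
          hmax (by positivity) (by positivity)
    _ = (q + 1) * |u - r| := by push_cast; ring

theorem abs_profile_sub_sub_le (q : ℕ) (r u : ℝ) :
    |profile q u - profile q r - profileDeriv q r * (u - r)| ≤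
      q / 2 * (q + 1) * (u - r) ^ 2 := by
  have h := (convex_uIcc r u).norm_image_sub_le_of_norm_hasDerivWithin_le
    (f := fun x => profile q x - profileDeriv q r * x)
    (f' := fun x => profileDeriv q x - profileDeriv q r * 1)
    (C := q / 2 * (q + 1) * |u - r|) (fun x _ =>
      ((hasDerivAt_profile q x).sub ((hasDerivAt_id x).const_mul _)).hasDerivWithinAt)
    (fun x hx => by
      rw [mul_one, Real.norm_eq_abs]
      refine (abs_profileDeriv_sub_le q r x).trans ?_
      exact mul_le_mul_of_nonneg_left (Set.abs_sub_left_of_mem_uIcc hx) (by positivity))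
    Set.left_mem_uIcc Set.right_mem_uIcc
  rw [Real.norm_eq_abs, Real.norm_eq_abs, mul_assoc, ← sq, sq_abs] at h
  convert h using 2
  ring

theorem exists_inv_one_sub_pow_le (k : ℕ) {ε : ℝ} (hε : 0 < ε) :
    ∃ η : ℝ, 0 < η ∧ η < 1 ∧ ((1 - η) ^ k)⁻¹ ≤ 1 + ε := by
  have hcont : ContinuousAt (fun η : ℝ => ((1 - η) ^ k)⁻¹) 0 :=
    ContinuousAt.inv₀ (by fun_prop) (by simp)
  have hle : ∀ᶠ η : ℝ in nhds 0, ((1 - η) ^ k)⁻¹ ≤ 1 + ε :=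
    hcont.eventually (eventually_le_nhds (by simpa using hε))
  have hlt : ∀ᶠ η : ℝ in nhdsWithin 0 (Set.Ioi 0), η < 1 ∧ ((1 - η) ^ k)⁻¹ ≤ 1 + ε :=
    nhdsWithin_le_nhds ((eventually_lt_nhds one_pos).and hle)
  obtain ⟨η, hη, hη0⟩ := (hlt.and self_mem_nhdsWithin).exists
  exact ⟨η, hη0, hη⟩

theorem profileDeriv_le_mul_profileDeriv {η r u : ℝ} (hη : η < 1) (h : |r - u| ≤ η * (1 + |r|))
    (q : ℕ) : profileDeriv q u ≤ profileDeriv q r * ((1 - η) ^ (q + 1))⁻¹ := by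
  have : 0 < 1 - η := by linarith
  have hu : (1 - η) * (1 + |r|) ≤ 1 + |u| := by linarith [abs_sub_abs_le_abs_sub r u]
  unfold profileDeriv
  rw [mul_assoc, ← mul_inv, ← mul_pow, mul_comm (1 + |r|)]
  gcongr

theorem abs_profile_sub_le_of_near {η r u : ℝ} (hη : η < 1)
    (h : |r - u| ≤ η * (1 + |r|)) (q : ℕ) :
    |profile q r - profile q u| ≤
      profileDeriv q r * (((1 - η) ^ (q + 1))⁻¹ * |r - u|) := by
  rw [abs_sub_comm, abs_sub_comm r u, ← mul_assoc]
  refine (convex_uIcc r u).norm_image_sub_le_of_norm_hasDerivWithin_le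
    (fun x _ => (hasDerivAt_profile q x).hasDerivWithinAt) (fun x hx => ?_)
    Set.left_mem_uIcc Set.right_mem_uIcc
  rw [Real.norm_eq_abs, abs_of_nonneg (profileDeriv_nonneg q x)]
  refine profileDeriv_le_mul_profileDeriv hη (le_trans ?_ h) q
  rw [abs_sub_comm r x, abs_sub_comm r u]
  exact Set.abs_sub_left_of_mem_uIcc hx

theorem abs_profile_sub_le_of_far {q : ℕ} (hq : 1 ≤ q) {η r u : ℝ} (hη : 0 < η)
    (h : η * (1 + |r|) ≤ |r - u|) :
    |profile q r - profile q u| ≤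
      profileDeriv q r * (2 / q * (η ^ (q + 1))⁻¹ * |r - u| ^ (q + 1)) := by
  calc |profile q r - profile q u| ≤ 1 := by
        rw [abs_le]
        constructor <;>
          linarith [profile_nonneg q r, profile_nonneg q u, profile_le_one q r,
            profile_le_one q u]
    _ = profileDeriv q r * (2 / q * (η ^ (q + 1))⁻¹ * (η * (1 + |r|)) ^ (q + 1)) := by
        have : 0 < 1 + |r| := by positivity
        have : (0 : ℝ) < q := by exact_mod_cast hq
        rw [profileDeriv, mul_pow]
        field_simp
    _ ≤ _ := by
        have := profileDeriv_nonneg q r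
        gcongr

/-- Long jumps cost the power `q + 1`: then `|profile q r - profile q u| ≤ 1`, and
`profileDeriv q r` is not smaller than a multiple of `|r - u| ^ (-(q + 1))`. -/
theorem exists_abs_profile_sub_le {q : ℕ} (hq : 1 ≤ q) {ε : ℝ} (hε : 0 < ε) :
    ∃ K : ℝ, 0 ≤ K ∧ ∀ r u : ℝ, |profile q r - profile q u| ≤
      profileDeriv q r * ((1 + ε) * |r - u| + K * |r - u| ^ (q + 1)) := by
  obtain ⟨η, hη0, hη1, hη⟩ := exists_inv_one_sub_pow_le (q + 1) hε
  refine ⟨2 / q * (η ^ (q + 1))⁻¹, by positivity, fun r u => ?_⟩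
  have hd := profileDeriv_nonneg q r
  rcases le_total |r - u| (η * (1 + |r|)) with h | h
  · refine (abs_profile_sub_le_of_near hη1 h q).trans (mul_le_mul_of_nonneg_left ?_ hd)
    exact le_add_of_le_of_nonneg (by gcongr) (by positivity)
  · refine (abs_profile_sub_le_of_far hq hη0 h).trans (mul_le_mul_of_nonneg_left ?_ hd)
    exact le_add_of_nonneg_left (by positivity)

/-! ### Expectations of multiplication operators under a Schrödinger evolution on `ℓ²` -/

section Multiplication

variable {I : Type*}

theorem summable_mul_of_abs_le {g F : I → ℝ} {K : ℝ} (hF : ∀ v, |F v| ≤ K) (hg : Summable g) :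
    Summable fun v => F v * g v :=
  Summable.of_norm_bounded (hg.norm.mul_left K) fun v => by
    rw [norm_mul]
    exact mul_le_mul_of_nonneg_right (hF v) (norm_nonneg _)

theorem hasSum_norm_sq (f : lp (fun _ : I => ℂ) 2) : HasSum (fun v => ‖f v‖ ^ 2) (‖f‖ ^ 2) := by
  simpa using lp.hasSum_norm (p := 2) (by norm_num) f

theorem summable_mul_norm_sq {F : I → ℝ} {K : ℝ} (hF : ∀ v, |F v| ≤ K)
    (f : lp (fun _ : I => ℂ) 2) : Summable fun v => F v * ‖f v‖ ^ 2 :=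
  summable_mul_of_abs_le hF (hasSum_norm_sq f).summable

/-- Multiplication by a bounded real function on `ℓ²`, as a bounded operator. -/
def mulOp (F : I → ℝ) {K : ℝ} (hF : ∀ v, |F v| ≤ K) :
    lp (fun _ : I => ℂ) 2 →L[ℂ] lp (fun _ : I => ℂ) 2 :=
  lp.mapCLM 2 (fun v => (F v : ℂ) • ContinuousLinearMap.id ℂ ℂ) (abs_nonneg K) fun v => by
    rw [norm_smul, ContinuousLinearMap.norm_id, mul_one, Complex.norm_real, Real.norm_eq_abs]
    exact (hF v).trans (le_abs_self K)

@[simp]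
theorem mulOp_apply (F : I → ℝ) {K : ℝ} (hF : ∀ v, |F v| ≤ K) (f : lp (fun _ : I => ℂ) 2)
    (v : I) : mulOp F hF f v = F v * f v := rfl

theorem norm_mulOp_le (F : I → ℝ) {K : ℝ} (hF : ∀ v, |F v| ≤ K) : ‖mulOp F hF‖ ≤ |K| :=
  lp.norm_mapCLM_le _ _ _ _

theorem hasDerivAt_mulOp {F F' : ℝ → I → ℝ} {K K' C : ℝ} (hF : ∀ t v, |F t v| ≤ K)
    (hF' : ∀ t v, |F' t v| ≤ K')
    (hd : ∀ t u v, |F u v - F t v - F' t v * (u - t)| ≤ C * (u - t) ^ 2) (t : ℝ) :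
    HasDerivAt (fun u => mulOp (F u) (hF u)) (mulOp (F' t) (hF' t)) t := by
  rw [hasDerivAt_iff_isLittleO]
  refine Asymptotics.IsBigO.trans_isLittleO (g := fun u => (u - t) ^ 2) ?_ ?_
  · refine Asymptotics.IsBigO.of_bound |C| (Filter.Eventually.of_forall fun u => ?_)
    have h : mulOp (F u) (hF u) - mulOp (F t) (hF t) - (u - t) • mulOp (F' t) (hF' t) =
        mulOp (fun v => F u v - F t v - F' t v * (u - t)) (hd t u) := by
      ext f v
      simp only [sub_apply, smul_apply, lp.coeFn_sub, Pi.sub_apply, lp.coeFn_smul, Pi.smul_apply,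
        mulOp_apply, Complex.real_smul]
      push_cast
      ring
    rw [h, Real.norm_eq_abs, ← abs_mul]
    exact norm_mulOp_le _ _
  · exact (Asymptotics.isLittleO_pow_sub_sub t one_lt_two).congr_left fun u => by
      rw [Real.norm_eq_abs, sq_abs]

theorem inner_mulOp_left (F : I → ℝ) {K : ℝ} (hF : ∀ v, |F v| ≤ K) (f h : lp (fun _ : I => ℂ) 2) :
    inner ℂ (mulOp F hF f) h = ∑' v, F v * (star (f v) * h v) := by
  rw [lp.inner_eq_tsum]
  refine tsum_congr fun v => ?_
  simp only [mulOp_apply, RCLike.inner_apply, map_mul, Complex.conj_ofReal, Complex.star_def]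
  ring

theorem isSymmetric_mulOp (F : I → ℝ) {K : ℝ} (hF : ∀ v, |F v| ≤ K) :
    (mulOp F hF : lp (fun _ : I => ℂ) 2 →ₗ[ℂ] lp (fun _ : I => ℂ) 2).IsSymmetric := by
  intro f h
  rw [ContinuousLinearMap.coe_coe, inner_mulOp_left, lp.inner_eq_tsum]
  refine tsum_congr fun v => ?_
  simp only [mulOp_apply, RCLike.inner_apply, Complex.star_def]
  ring

theorem re_inner_mulOp (F : I → ℝ) {K : ℝ} (hF : ∀ v, |F v| ≤ K) (f : lp (fun _ : I => ℂ) 2) :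
    (inner ℂ f (mulOp F hF f)).re = ∑' v, F v * ‖f v‖ ^ 2 := by
  rw [lp.inner_eq_tsum, Complex.re_tsum (lp.summable_inner _ _)]
  refine tsum_congr fun v => ?_
  rw [mulOp_apply, RCLike.inner_apply, mul_assoc, Complex.mul_conj, ← Complex.ofReal_mul,
    Complex.ofReal_re, Complex.normSq_eq_norm_sq]

theorem im_inner_mulOp_left (F : I → ℝ) {K : ℝ} (hF : ∀ v, |F v| ≤ K)
    (f h : lp (fun _ : I => ℂ) 2) :
    (inner ℂ (mulOp F hF f) h).im = ∑' v, F v * (star (f v) * h v).im := by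
  have hsum := lp.summable_inner (𝕜 := ℂ) (mulOp F hF f) h
  rw [lp.inner_eq_tsum, Complex.im_tsum hsum]
  refine tsum_congr fun v => ?_
  rw [← Complex.im_ofReal_mul]
  congr 1
  simp only [mulOp_apply, RCLike.inner_apply, map_mul, Complex.conj_ofReal, Complex.star_def]
  ring

theorem hasDerivAt_re_inner_apply {H : Type*} [NormedAddCommGroup H] [InnerProductSpace ℂ H]
    {ψ : ℝ → H} {h : H} {M : ℝ → H →L[ℂ] H} {M' : H →L[ℂ] H} {t : ℝ}
    (hψ : HasDerivAt ψ (-Complex.I • h) t) (hM : HasDerivAt M M' t)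
    (hsymm : (M t : H →ₗ[ℂ] H).IsSymmetric) :
    HasDerivAt (fun u => (inner ℂ (ψ u) (M u (ψ u))).re)
      ((inner ℂ (ψ t) (M' (ψ t))).re + 2 * (inner ℂ (M t (ψ t)) h).im) t := by
  have hMψ : HasDerivAt (fun u => M u (ψ u)) (M' (ψ t) + M t (-Complex.I • h)) t :=
    ((ContinuousLinearMap.restrictScalarsL ℂ H H ℝ ℝ).hasFDerivAt.comp_hasDerivAt t hM).clm_apply
      hψ
  have hright : inner ℂ (ψ t) (M t (-Complex.I • h)) = -Complex.I * inner ℂ (M t (ψ t)) h := by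
    rw [← inner_smul_right]
    exact (hsymm (ψ t) _).symm
  have hleft : inner ℂ (-Complex.I • h) (M t (ψ t)) =
      Complex.I * star (inner ℂ (M t (ψ t)) h) := by
    rw [inner_smul_left, Complex.star_def, inner_conj_symm, map_neg, Complex.conj_I, neg_neg]
  refine (Complex.reCLM.hasFDerivAt.comp_hasDerivAt t (hψ.inner ℂ hMψ)).congr_deriv ?_
  rw [Complex.reCLM_apply, inner_add_right, hright, hleft, Complex.star_def]
  generalize inner ℂ (M t (ψ t)) h = z
  simp only [neg_mul, Complex.add_re, Complex.neg_re, Complex.mul_re, Complex.I_re, zero_mul,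
    Complex.I_im, one_mul, zero_sub, neg_neg, Complex.conj_re, Complex.conj_im, mul_neg,
    sub_neg_eq_add, zero_add]
  ring

theorem two_mul_tsum_mul_le_of_antisymm {m D : I × I → ℝ} (hm : ∀ z, m z.swap = -m z)
    (hD : Summable D) (hmD : ∀ z, |m z| ≤ 2⁻¹ * (D z + D z.swap)) {F : I → ℝ} {K : ℝ}
    (hF : ∀ v, |F v| ≤ K) :
    2 * ∑' z, F z.1 * m z ≤ ∑' z, |F z.1 - F z.2| * D z := by
  have hD' : Summable fun z : I × I => D z.swap := (Equiv.prodComm I I).summable_iff.2 hD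
  have hms : Summable m := Summable.of_norm_bounded ((hD.add hD').mul_left 2⁻¹) hmD
  have hW (z : I × I) : |(|F z.1 - F z.2|)| ≤ K + K := by
    rw [abs_abs]
    exact (abs_sub _ _).trans (add_le_add (hF _) (hF _))
  have hFm₁ := summable_mul_of_abs_le (fun z : I × I => hF z.1) hms
  have hFm₂ := summable_mul_of_abs_le (fun z : I × I => hF z.2) hms
  have hWD := summable_mul_of_abs_le hW hD
  have hWD' := summable_mul_of_abs_le hW hD'
  have hswap : ∑' z, F z.1 * m z = -∑' z, F z.2 * m z := by
    rw [← (Equiv.prodComm I I).tsum_eq, ← tsum_neg]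
    exact tsum_congr fun z => by simp [hm]
  have hsymm : ∑' z : I × I, |F z.1 - F z.2| * D z.swap = ∑' z, |F z.1 - F z.2| * D z := by
    rw [← (Equiv.prodComm I I).tsum_eq]
    exact tsum_congr fun z => by simp [abs_sub_comm (F z.2)]
  calc 2 * ∑' z, F z.1 * m z = ∑' z, (F z.1 * m z - F z.2 * m z) := by
        rw [hFm₁.tsum_sub hFm₂]
        linarith
    _ ≤ ∑' z, (2⁻¹ * (|F z.1 - F z.2| * D z) + 2⁻¹ * (|F z.1 - F z.2| * D z.swap)) := by
        refine (hFm₁.sub hFm₂).tsum_le_tsum (fun z => ?_)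
          ((hWD.mul_left _).add (hWD'.mul_left _))
        rw [← sub_mul, ← mul_add, ← mul_add, mul_left_comm]
        refine (le_abs_self _).trans ?_
        rw [abs_mul]
        exact mul_le_mul_of_nonneg_left (hmD z) (abs_nonneg _)
    _ = ∑' z, |F z.1 - F z.2| * D z := by
        rw [(hWD.mul_left _).tsum_add (hWD'.mul_left _), tsum_mul_left, tsum_mul_left, hsymm]
        ring

section HermitianKernel

variable {M : I → I → ℂ} (hM : ∀ v w, M w v = star (M v w))

include hM in
theorem norm_kernel_comm (v w : I) : ‖M w v‖ = ‖M v w‖ := by rw [hM v w, norm_star]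

include hM in
theorem norm_star_mul_mul_le (f : I → ℂ) (v w : I) :
    ‖star (f v) * (M v w * f w)‖ ≤
      2⁻¹ * (‖M v w‖ * ‖f v‖ ^ 2 + ‖M w v‖ * ‖f w‖ ^ 2) := by
  rw [norm_mul, norm_mul, norm_star, norm_kernel_comm hM v w]
  nlinarith [mul_nonneg (norm_nonneg (M v w)) (sq_nonneg (‖f v‖ - ‖f w‖))]

include hM in
theorem im_star_mul_mul_comm (f : I → ℂ) (v w : I) :
    (star (f w) * (M w v * f v)).im = -(star (f v) * (M v w * f w)).im := by
  rw [← Complex.conj_im, ← Complex.star_def, hM v w]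
  simp only [star_mul', star_star]
  ring_nf

variable {C : ℝ} (hs : ∀ v, Summable fun w => ‖M v w‖) (hC : ∀ v, ∑' w, ‖M v w‖ ≤ C)
include hs hC

theorem summable_norm_kernel_mul_norm_sq {f : I → ℂ} (hf : Summable fun v => ‖f v‖ ^ 2) :
    Summable fun z : I × I => ‖M z.1 z.2‖ * ‖f z.1‖ ^ 2 := by
  have h0 (z : I × I) : 0 ≤ ‖M z.1 z.2‖ * ‖f z.1‖ ^ 2 := by positivity
  have hrow : Summable fun v => (∑' w, ‖M v w‖) * ‖f v‖ ^ 2 :=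
    (hf.mul_left C).of_nonneg_of_le
      (fun v => mul_nonneg (tsum_nonneg fun w => norm_nonneg _) (sq_nonneg _))
      fun v => mul_le_mul_of_nonneg_right (hC v) (sq_nonneg _)
  rw [summable_prod_of_nonneg h0]
  exact ⟨fun v => (hs v).mul_right (‖f v‖ ^ 2), by simpa only [tsum_mul_right] using hrow⟩

include hM

/-- `Im (conj (f v) * M v w * f w)` is the current from `w` to `v`. It is antisymmetric, so only
the differences `F v - F w` contribute to the left side. -/
theorem two_mul_tsum_im_le {F : I → ℝ} {K : ℝ} (hF : ∀ v, |F v| ≤ K) {f : I → ℂ}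
    (hf : Summable fun v => ‖f v‖ ^ 2) :
    2 * ∑' v, F v * (star (f v) * ∑' w, M v w * f w).im ≤
      ∑' v, (∑' w, |F v - F w| * ‖M v w‖) * ‖f v‖ ^ 2 := by
  have hD := summable_norm_kernel_mul_norm_sq hs hC hf
  have hD' : Summable fun z : I × I => ‖M z.2 z.1‖ * ‖f z.2‖ ^ 2 :=
    (Equiv.prodComm I I).summable_iff.2 hD
  have hcur : Summable fun z : I × I => star (f z.1) * (M z.1 z.2 * f z.2) :=
    Summable.of_norm_bounded ((hD.add hD').mul_left 2⁻¹) fun z => norm_star_mul_mul_le hM f z.1 z.2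
  have hcurF := summable_mul_of_abs_le (fun z : I × I => hF z.1)
    (Complex.hasSum_im hcur.hasSum).summable
  have hleft : ∑' v, F v * (star (f v) * ∑' w, M v w * f w).im =
      ∑' z : I × I, F z.1 * (star (f z.1) * (M z.1 z.2 * f z.2)).im := by
    rw [hcurF.tsum_prod]
    refine tsum_congr fun v => ?_
    rw [← tsum_mul_left, Complex.im_tsum (hcur.prod_factor v), ← tsum_mul_left]
  have hW (z : I × I) : |(|F z.1 - F z.2|)| ≤ K + K := by
    rw [abs_abs]
    exact (abs_sub _ _).trans (add_le_add (hF _) (hF _))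
  have hright : ∑' z : I × I, |F z.1 - F z.2| * (‖M z.1 z.2‖ * ‖f z.1‖ ^ 2) =
      ∑' v, (∑' w, |F v - F w| * ‖M v w‖) * ‖f v‖ ^ 2 := by
    rw [(summable_mul_of_abs_le hW hD).tsum_prod]
    refine tsum_congr fun v => ?_
    rw [← tsum_mul_right]
    exact tsum_congr fun w => (mul_assoc _ _ _).symm
  rw [hleft, ← hright]
  exact two_mul_tsum_mul_le_of_antisymm (fun z => im_star_mul_mul_comm hM f z.1 z.2) hD
    (fun z => (Complex.abs_im_le_norm _).trans (norm_star_mul_mul_le hM f z.1 z.2)) hF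

theorem antitone_tsum_mul_norm_sq {ψ h : ℝ → lp (fun _ : I => ℂ) 2}
    (hψ : ∀ t, HasDerivAt ψ (-Complex.I • h t) t) (hh : ∀ t v, h t v = ∑' w, M v w * ψ t w)
    {F F' : ℝ → I → ℝ} {K K' D : ℝ} (hF : ∀ t v, |F t v| ≤ K) (hF' : ∀ t v, |F' t v| ≤ K')
    (hd : ∀ t u v, |F u v - F t v - F' t v * (u - t)| ≤ D * (u - t) ^ 2)
    (hV : ∀ t v, ∑' w, |F t v - F t w| * ‖M v w‖ ≤ -F' t v) :
    Antitone fun t => ∑' v, F t v * ‖ψ t v‖ ^ 2 := by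
  have hderiv (t : ℝ) := hasDerivAt_re_inner_apply (hψ t) (hasDerivAt_mulOp hF hF' hd t)
    (isSymmetric_mulOp (F t) (hF t))
  simp only [re_inner_mulOp, im_inner_mulOp_left, hh] at hderiv
  refine antitone_of_hasDerivAt_nonpos hderiv fun t => ?_
  have hflux := two_mul_tsum_im_le hM hs hC (hF t) (hasSum_norm_sq (ψ t)).summable
  have hV0 (v : I) : 0 ≤ ∑' w, |F t v - F t w| * ‖M v w‖ := tsum_nonneg fun w => by positivity
  have hdecay : ∑' v, (∑' w, |F t v - F t w| * ‖M v w‖) * ‖ψ t v‖ ^ 2 ≤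
      ∑' v, -(F' t v * ‖ψ t v‖ ^ 2) := by
    refine Summable.tsum_le_tsum (fun v => ?_) ?_ (summable_mul_norm_sq (hF' t) (ψ t)).neg
    · rw [← neg_mul]
      exact mul_le_mul_of_nonneg_right (hV t v) (sq_nonneg _)
    · refine summable_mul_norm_sq (K := K') (fun v => ?_) (ψ t)
      rw [abs_of_nonneg (hV0 v)]
      exact (hV t v).trans ((neg_le_abs _).trans (hF' t v))
  rw [tsum_neg] at hdecay
  rw [Pi.zero_apply]
  linarith

end HermitianKernel

end Multiplication

/-! ### Second quantization of a function on the sites -/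

section SecondQuantization

variable {S : Type*} {m : ℕ} {f f' : S → ℝ} {K K' : ℝ}

/-- The second quantization of multiplication by `f`, which multiplies an `m`-particle wave
function by `v ↦ f (v 0) + ⋯ + f (v (m - 1))`. -/
def dGamma (f : S → ℝ) (v : Fin m → S) : ℝ := ∑ i, f (v i)

/-- The expectation of the second quantization of `f` in an `m`-particle state. It is a junk value
unless the defining series converges, for which it suffices that `f` is bounded. -/
def dGammaExpect (f : S → ℝ) (ψ : Sector S m) : ℝ := ∑' v, dGamma f v * ‖ψ.toFun v‖ ^ 2

theorem abs_dGamma_le (hf : ∀ x, |f x| ≤ K) (v : Fin m → S) : |dGamma f v| ≤ m * K :=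
  (Finset.abs_sum_le_sum_abs _ _).trans <|
    (Finset.sum_le_card_nsmul _ _ K fun i _ => hf (v i)).trans_eq (by simp)

theorem dGamma_mono (h : f ≤ f') (v : Fin m → S) : dGamma f v ≤ dGamma f' v :=
  Finset.sum_le_sum fun i _ => h (v i)

theorem dGamma_nonneg (hf : 0 ≤ f) (v : Fin m → S) : 0 ≤ dGamma f v :=
  Finset.sum_nonneg fun i _ => hf (v i)

theorem dGamma_sub_dGamma_update (f : S → ℝ) (v : Fin m → S) (i : Fin m) (y : S) :
    dGamma f v - dGamma f (Function.update v i y) = f (v i) - f y := by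
  unfold dGamma
  rw [← Finset.sum_sub_distrib, Finset.sum_eq_single i]
  · simp
  · intro j _ hj
    simp [hj]
  · simp

/-- The inclusion of the `m`-particle space into `ℓ²(Sᵐ)`. -/
def sectorIncl (S : Type*) (m : ℕ) : Sector S m →L[ℂ] lp (fun _ : Fin m → S => ℂ) 2 :=
  (symmFun S m).subtypeL

theorem summable_dGamma_mul_norm_sq (hf : ∀ x, |f x| ≤ K) (ψ : Sector S m) :
    Summable fun v => dGamma f v * ‖ψ.toFun v‖ ^ 2 :=
  summable_mul_norm_sq (abs_dGamma_le hf) (sectorIncl S m ψ)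

theorem dGammaExpect_mono (hf : ∀ x, |f x| ≤ K) (hf' : ∀ x, |f' x| ≤ K') (h : f ≤ f')
    (ψ : Sector S m) : dGammaExpect f ψ ≤ dGammaExpect f' ψ :=
  (summable_dGamma_mul_norm_sq hf ψ).tsum_le_tsum
    (fun v => mul_le_mul_of_nonneg_right (dGamma_mono h v) (sq_nonneg _))
    (summable_dGamma_mul_norm_sq hf' ψ)

theorem dGammaExpect_add_smul (hf : ∀ x, |f x| ≤ K) (hf' : ∀ x, |f' x| ≤ K') (a : ℝ)
    (ψ : Sector S m) :
    dGammaExpect (f + a • f') ψ = dGammaExpect f ψ + a * dGammaExpect f' ψ := by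
  have hs := summable_dGamma_mul_norm_sq hf ψ
  have hs' := summable_dGamma_mul_norm_sq hf' ψ
  rw [dGammaExpect, dGammaExpect, dGammaExpect, ← tsum_mul_left, ← hs.tsum_add (hs'.mul_left a)]
  refine tsum_congr fun v => ?_
  simp only [dGamma, Pi.add_apply, Pi.smul_apply, smul_eq_mul, Finset.sum_add_distrib,
    ← Finset.mul_sum]
  ring

end SecondQuantization

/-! ### Evolution of second quantized observables -/

section Evolution

variable {S : Type*} {m : ℕ} {Λ : Set S} {J : Λ → Λ → ℂ} {B : ℝ}

theorem hasDerivAt_sectorEvol (Λ : Set S) (J : Λ → Λ → ℂ) (g μ : ℝ) (φ : Sector S m)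
    (t : ℝ) : HasDerivAt (fun u => sectorEvol Λ J g μ u m φ)
      (-Complex.I • sectorHam Λ J g μ m (sectorEvol Λ J g μ t m φ)) t := by
  have hexp : ∀ u : ℝ, (-(Complex.I * (u : ℂ))) • sectorHam Λ J g μ m =
      u • (-Complex.I • sectorHam Λ J g μ m) := fun u => by
    rw [← Complex.coe_smul u, smul_smul]
    congr 1
    ring
  simp only [sectorEvol, hexp]
  exact (ContinuousLinearMap.apply ℂ (Sector S m) φ).restrictScalars ℝ
    |>.hasFDerivAt.comp_hasDerivAt t
      (hasDerivAt_exp_smul_const' (𝕂 := ℝ) (-Complex.I • sectorHam Λ J g μ m) t)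

theorem sectorEvol_zero (Λ : Set S) (J : Λ → Λ → ℂ) (g μ : ℝ) (m : ℕ) :
    sectorEvol Λ J g μ 0 m = 1 := by
  simp [sectorEvol, NormedSpace.exp_zero]

theorem sectorWave_self (φ : Sector S m) : sectorWave φ m = φ.toFun :=
  Pi.single_eq_same (M := fun m => (Fin m → S) → ℂ) m φ.toFun

theorem toFun_comp_perm (φ : Sector S m) (σ : Equiv.Perm (Fin m)) (v : Fin m → S) :
    φ.toFun (v ∘ σ) = φ.toFun v :=
  (show symmFun S m from φ).2 σ v

section Kernel

variable (hs : ∀ x, Summable fun y => ‖J x y‖)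

include hs

theorem sectorHam_toFun (hJ : ∀ x y, J y x = star (J x y)) (hB : ∀ x, ∑' y, ‖J x y‖ ≤ B)
    (g μ : ℝ) (φ : Sector S m) (v : Fin m → S) :
    (sectorHam Λ J g μ m φ).toFun v = ∑' w, kernel Λ J g μ m v w * φ.toFun w := by
  rw [sectorHam_apply Λ J hJ B hs hB,
    hamExpr_eq Λ J hs g μ m (sectorWave φ) ?_ ‖φ‖ ?_ v, sectorWave_self]
  · simpa only [sectorWave_self] using toFun_comp_perm φ
  · simp only [sectorWave_self]
    exact lp.norm_apply_le_norm two_ne_zero (sectorIncl S m φ)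

theorem exists_hasSum_abs_dGamma_sub_mul_norm_hop {f V : S → ℝ} {K : ℝ} (hf : ∀ x, |f x| ≤ K)
    (hV₀ : 0 ≤ V) (hV : ∀ x : Λ, ∑' y : Λ, |f x - f y| * ‖J x y‖ ≤ V x) (v : Fin m → S)
    (i : Fin m) :
    ∃ a ≤ V (v i), HasSum (fun w => |dGamma f v - dGamma f w| * ‖hop Λ J m i v w‖) a := by
  classical
  by_cases h : v i ∈ Λ
  · refine ⟨∑' y : Λ, |f (v i) - f y| * ‖J ⟨v i, h⟩ y‖, hV ⟨v i, h⟩, ?_⟩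
    refine hasSum_hop Λ J m i v (fun z w => |dGamma f v - dGamma f w| * ‖z‖)
      (fun w => by simp) h ?_
    simp only [dGamma_sub_dGamma_update]
    refine (summable_mul_of_abs_le (K := 2 * K) (fun y => ?_) (hs ⟨v i, h⟩)).hasSum
    rw [abs_abs]
    exact (abs_sub _ _).trans (by linarith [hf (v i), hf y])
  · refine ⟨0, hV₀ _, ?_⟩
    have hzero : ∀ w, hop Λ J m i v w = 0 := fun w => dif_neg fun h' => h h'.1
    simp only [hzero, norm_zero, mul_zero]
    exact hasSum_zero

/-- Differences along the kernel only see the hopping: the interaction is diagonal. -/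
theorem tsum_abs_dGamma_sub_mul_norm_kernel_le {f V : S → ℝ} {K : ℝ} (hf : ∀ x, |f x| ≤ K)
    (hV₀ : 0 ≤ V) (hV : ∀ x : Λ, ∑' y : Λ, |f x - f y| * ‖J x y‖ ≤ V x) (g μ : ℝ)
    (v : Fin m → S) :
    ∑' w, |dGamma f v - dGamma f w| * ‖kernel Λ J g μ m v w‖ ≤ dGamma V v := by
  classical
  choose a haV ha using exists_hasSum_abs_dGamma_sub_mul_norm_hop hs hf hV₀ hV v
  have hsum := hasSum_sum fun i (_ : i ∈ Finset.univ) => ha i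
  have hle : ∀ w, |dGamma f v - dGamma f w| * ‖kernel Λ J g μ m v w‖ ≤
      ∑ i, |dGamma f v - dGamma f w| * ‖hop Λ J m i v w‖ := by
    intro w
    by_cases hw : w = v
    · subst hw
      simp
    · rw [← Finset.mul_sum, kernel, if_neg hw, zero_sub, norm_neg]
      exact mul_le_mul_of_nonneg_left (norm_sum_le _ _) (abs_nonneg _)
  calc ∑' w, |dGamma f v - dGamma f w| * ‖kernel Λ J g μ m v w‖
      ≤ ∑' w, ∑ i, |dGamma f v - dGamma f w| * ‖hop Λ J m i v w‖ :=
        (hsum.summable.of_nonneg_of_le (fun w => by positivity) hle).tsum_le_tsum hle hsum.summable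
    _ = ∑ i, a i := hsum.tsum_eq
    _ ≤ dGamma V v := Finset.sum_le_sum fun i _ => haV i

theorem antitone_dGammaExpect_sectorEvol (hJ : ∀ x y, J y x = star (J x y))
    (hB : ∀ x, ∑' y, ‖J x y‖ ≤ B) {f f' : ℝ → S → ℝ} {K K' D : ℝ} (hf : ∀ t x, |f t x| ≤ K)
    (hf' : ∀ t x, |f' t x| ≤ K')
    (hd : ∀ t u x, |f u x - f t x - f' t x * (u - t)| ≤ D * (u - t) ^ 2)
    (hf'₀ : ∀ t x, f' t x ≤ 0)
    (hV : ∀ t (x : Λ), ∑' y : Λ, |f t x - f t y| * ‖J x y‖ ≤ -f' t x)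
    (g μ : ℝ) (φ : Sector S m) :
    Antitone fun t => dGammaExpect (f t) (sectorEvol Λ J g μ t m φ) := by
  have hψ : ∀ t, HasDerivAt (fun t => sectorIncl S m (sectorEvol Λ J g μ t m φ))
      (-Complex.I • sectorIncl S m (sectorHam Λ J g μ m (sectorEvol Λ J g μ t m φ))) t := fun t =>
    (((sectorIncl S m).restrictScalars ℝ).hasFDerivAt.comp_hasDerivAt t
      (hasDerivAt_sectorEvol Λ J g μ φ t)).congr_deriv (map_smul (sectorIncl S m) _ _)
  have hderiv : ∀ t u (v : Fin m → S),
      |dGamma (f u) v - dGamma (f t) v - dGamma (f' t) v * (u - t)| ≤ m * D * (u - t) ^ 2 := by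
    intro t u v
    have h := abs_dGamma_le (hd t u) v
    simpa only [dGamma, Finset.sum_sub_distrib, Finset.sum_mul, mul_assoc] using h
  have hflux : ∀ t (v : Fin m → S),
      ∑' w, |dGamma (f t) v - dGamma (f t) w| * ‖kernel Λ J g μ m v w‖ ≤ -dGamma (f' t) v := by
    intro t v
    have h := tsum_abs_dGamma_sub_mul_norm_kernel_le hs (hf t) (V := -f' t)
      (fun x => neg_nonneg.2 (hf'₀ t x)) (hV t) g μ v
    simpa only [dGamma, Pi.neg_apply, Finset.sum_neg_distrib] using h
  exact antitone_tsum_mul_norm_sq (kernel_star Λ J hJ g μ m)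
    (fun v => (summable_norm_kernel Λ J B hs hB g μ m v).1)
    (fun v => (summable_norm_kernel Λ J B hs hB g μ m v).2) hψ
    (fun t v => sectorHam_toFun hs hJ hB g μ _ v)
    (fun t => abs_dGamma_le (hf t)) (fun t => abs_dGamma_le (hf' t)) hderiv hflux

end Kernel

end Evolution

/-! ### Particle numbers -/

section Particles

variable {S : Type*} {m : ℕ} {Λ A A' : Set S}

theorem abs_indicator_one_le (A : Set S) (x : S) : |A.indicator (1 : S → ℝ) x| ≤ 1 := by
  by_cases h : x ∈ A <;> simp [h]

theorem indicator_one_nonneg (A : Set S) : 0 ≤ A.indicator (1 : S → ℝ) :=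
  Set.indicator_nonneg fun _ _ => zero_le_one

theorem tsum_fin_cons (F : (Fin (m + 1) → S) → ℝ≥0∞) :
    ∑' v, F v = ∑' x, ∑' w : Fin m → S, F (Fin.cons x w) := by
  rw [← (Fin.consEquiv fun _ => S).tsum_eq, ENNReal.tsum_prod']
  rfl

theorem tsum_mul_apply_eq_tsum_mul_apply_zero (f : S → ℝ≥0∞) {F : (Fin (m + 1) → S) → ℝ≥0∞}
    (hF : ∀ (σ : Equiv.Perm (Fin (m + 1))) v, F (v ∘ σ) = F v) (i : Fin (m + 1)) :
    ∑' v, f (v i) * F v = ∑' v, f (v 0) * F v := by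
  rw [← ((Equiv.swap 0 i).arrowCongr (Equiv.refl S)).tsum_eq]
  refine tsum_congr fun v => ?_
  have hv : ((Equiv.swap 0 i).arrowCongr (Equiv.refl S)) v = v ∘ Equiv.swap 0 i := by
    ext j
    simp [Equiv.arrowCongr]
  rw [hv, hF, Function.comp_apply, Equiv.swap_apply_right]

theorem ofReal_dGammaExpect_indicator (A : Set S) (ψ : Sector S m) :
    ENNReal.ofReal (dGammaExpect (A.indicator 1) ψ) =
      ∑ i : Fin m, ∑' v : Fin m → S, A.indicator 1 (v i) * ‖ψ.toFun v‖ₑ ^ 2 := by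
  have hnonneg : ∀ v : Fin m → S, 0 ≤ dGamma (A.indicator 1) v :=
    dGamma_nonneg (indicator_one_nonneg A)
  rw [dGammaExpect, ENNReal.ofReal_tsum_of_nonneg
    (fun v => mul_nonneg (hnonneg v) (sq_nonneg _))
    (summable_dGamma_mul_norm_sq (abs_indicator_one_le A) ψ),
    ← Summable.tsum_finsetSum fun i _ => ENNReal.summable]
  refine tsum_congr fun v => ?_
  rw [ENNReal.ofReal_mul (hnonneg v), dGamma,
    ENNReal.ofReal_sum_of_nonneg fun i _ => indicator_one_nonneg A (v i), Finset.sum_mul]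
  refine Finset.sum_congr rfl fun i _ => ?_
  rw [ENNReal.ofReal_pow (norm_nonneg _), ofReal_norm]
  by_cases h : v i ∈ A <;> simp [h]

theorem enorm_sqrt_natCast_add_one_sq (m : ℕ) : ‖((√((m : ℝ) + 1) : ℝ) : ℂ)‖ₑ ^ 2 = m + 1 := by
  rw [← ofReal_norm, ← ENNReal.ofReal_pow (norm_nonneg _), Complex.norm_real, Real.norm_eq_abs,
    sq_abs, Real.sq_sqrt (by positivity), ← Nat.cast_succ, ENNReal.ofReal_natCast, Nat.cast_succ]

theorem ofReal_dGammaExpect_indicator_succ (A : Set S) (ψ : Sector S (m + 1)) :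
    ENNReal.ofReal (dGammaExpect (A.indicator 1) ψ) = ∑' x : A, ∑' v : Fin m → S,
      ‖((√((m : ℝ) + 1) : ℝ) : ℂ) * ψ.toFun (Fin.cons (x : S) v)‖ₑ ^ 2 := by
  have hperm : ∀ (σ : Equiv.Perm (Fin (m + 1))) v, ‖ψ.toFun (v ∘ σ)‖ₑ ^ 2 = ‖ψ.toFun v‖ₑ ^ 2 :=
    fun σ v => by rw [toFun_comp_perm]
  rw [ofReal_dGammaExpect_indicator, Finset.sum_congr rfl fun i _ =>
    tsum_mul_apply_eq_tsum_mul_apply_zero (A.indicator 1) hperm i, Finset.sum_const,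
    Finset.card_univ, Fintype.card_fin, tsum_fin_cons, nsmul_eq_mul, ← ENNReal.tsum_mul_left,
    tsum_subtype A fun x =>
      ∑' v : Fin m → S, ‖((√((m : ℝ) + 1) : ℝ) : ℂ) * ψ.toFun (Fin.cons x v)‖ₑ ^ 2]
  refine tsum_congr fun x => ?_
  by_cases hx : x ∈ A
  · simp [hx, enorm_mul, mul_pow, enorm_sqrt_natCast_add_one_sq, ENNReal.tsum_mul_left]
  · simp [hx]

theorem particles_eq_tsum (A : Set S) (φ : Fock S) :
    particles A φ = ∑' m, ENNReal.ofReal (dGammaExpect (A.indicator 1) (φ m)) := by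
  rw [tsum_eq_zero_add' ENNReal.summable, particles, ENNReal.tsum_comm,
    ofReal_dGammaExpect_indicator, Finset.univ_eq_empty, Finset.sum_empty, zero_add]
  exact tsum_congr fun m => (ofReal_dGammaExpect_indicator_succ A _).symm

theorem particles_mono (h : A ⊆ A') (φ : Fock S) : particles A φ ≤ particles A' φ :=
  ENNReal.tsum_mono_subtype
    (fun x => ∑' m : ℕ, ∑' v : Fin m → S, ‖annih x (fockWave φ) m v‖ₑ ^ 2) h

theorem particles_le_add {φ φ₁ φ₂ : Fock S} {A₁ A₂ : Set S} {a : ℝ} (ha : 0 ≤ a)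
    (h : ∀ m, dGammaExpect (A.indicator 1) (φ m) ≤
      dGammaExpect (A₁.indicator 1) (φ₁ m) + a * dGammaExpect (A₂.indicator 1) (φ₂ m)) :
    particles A φ ≤ particles A₁ φ₁ + ENNReal.ofReal a * particles A₂ φ₂ := by
  rw [particles_eq_tsum, particles_eq_tsum, particles_eq_tsum, ← ENNReal.tsum_mul_left,
    ← ENNReal.tsum_add]
  refine ENNReal.tsum_le_tsum fun m => ?_
  rw [← ENNReal.ofReal_mul ha]
  exact (ENNReal.ofReal_le_ofReal (h m)).trans ENNReal.ofReal_add_le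

variable {J : Λ → Λ → ℂ} {B : ℝ} (hJ : ∀ x y, J y x = star (J x y))
  (hs : ∀ x, Summable fun y => ‖J x y‖) (hB : ∀ x, ∑' y, ‖J x y‖ ≤ B)

include hJ hs hB

theorem dGammaExpect_sectorEvol_le (g μ : ℝ) {t : ℝ} (ht : 0 ≤ t) (φ : Sector S m) :
    dGammaExpect (Λ.indicator 1) (sectorEvol Λ J g μ t m φ) ≤
      dGammaExpect (Λ.indicator 1) φ := by
  have h := antitone_dGammaExpect_sectorEvol hs hJ hB (f := fun _ => Λ.indicator 1) (f' := 0)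
    (K' := 0) (D := 0) (fun _ => abs_indicator_one_le Λ) (by simp) (by simp) (by simp) (by simp)
    g μ φ ht
  simpa [sectorEvol_zero] using h

theorem particles_evol_le (g μ : ℝ) {t : ℝ} (ht : 0 ≤ t) (φ : Fock S) :
    particles Λ (evol Λ J g μ t φ) ≤ particles Λ φ := by
  rw [particles_eq_tsum, particles_eq_tsum]
  exact ENNReal.tsum_le_tsum fun m => ENNReal.ofReal_le_ofReal
    (dGammaExpect_sectorEvol_le hJ hs hB g μ ht (φ m))

/-- An observable whose expectation decreases and which is squeezed between `χ_A` at time `t` and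
`χ_{A'}` at time `0`, both up to `a`, controls the number of particles. -/
theorem particles_evol_le_add {f₀ f₁ : S → ℝ} {K K' a t : ℝ} (ha : 0 ≤ a) (ht : 0 ≤ t)
    (hf₀ : ∀ x, |f₀ x| ≤ K) (hf₁ : ∀ x, |f₁ x| ≤ K')
    (h₀ : f₀ ≤ A'.indicator 1 + a • Λ.indicator 1) (h₁ : A.indicator 1 ≤ f₁ + a • Λ.indicator 1)
    (g μ : ℝ) (hf : ∀ (m : ℕ) (ψ : Sector S m),
      dGammaExpect f₁ (sectorEvol Λ J g μ t m ψ) ≤ dGammaExpect f₀ ψ) (φ : Fock S) :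
    particles A (evol Λ J g μ t φ) ≤
      particles A' φ + ENNReal.ofReal (2 * a) * particles Λ φ := by
  have hbdd : ∀ {k : S → ℝ} {C : ℝ}, (∀ x, |k x| ≤ C) →
      ∀ x, |(k + a • Λ.indicator (1 : S → ℝ)) x| ≤ C + a * 1 := fun hk x => by
    refine (abs_add_le _ _).trans (add_le_add (hk x) ?_)
    rw [Pi.smul_apply, smul_eq_mul, abs_mul, abs_of_nonneg ha]
    exact mul_le_mul_of_nonneg_left (abs_indicator_one_le Λ x) ha
  refine particles_le_add (by positivity) fun m => ?_
  set ψ := sectorEvol Λ J g μ t m (φ m)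
  calc dGammaExpect (A.indicator 1) ψ
      ≤ dGammaExpect (f₁ + a • Λ.indicator 1) ψ :=
        dGammaExpect_mono (abs_indicator_one_le A) (hbdd hf₁) h₁ ψ
    _ = dGammaExpect f₁ ψ + a * dGammaExpect (Λ.indicator 1) ψ :=
        dGammaExpect_add_smul hf₁ (abs_indicator_one_le Λ) a ψ
    _ ≤ dGammaExpect f₀ (φ m) + a * dGammaExpect (Λ.indicator 1) (φ m) :=
        add_le_add (hf m (φ m)) (mul_le_mul_of_nonneg_left
          (dGammaExpect_sectorEvol_le hJ hs hB g μ ht (φ m)) ha)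
    _ ≤ dGammaExpect (A'.indicator 1 + a • Λ.indicator 1) (φ m) +
          a * dGammaExpect (Λ.indicator 1) (φ m) := by
        gcongr
        exact dGammaExpect_mono hf₀ (hbdd (abs_indicator_one_le A')) h₀ _
    _ = dGammaExpect (A'.indicator 1) (φ m) + 2 * a * dGammaExpect (Λ.indicator 1) (φ m) := by
        rw [dGammaExpect_add_smul (abs_indicator_one_le A') (abs_indicator_one_le Λ)]
        ring

end Particles

/-! ### Moments of the hopping matrix -/

section Moments

theorem tsum_enorm_mul_edist_pow_le_kappa {S : Type*} [PseudoEMetricSpace S] (Λ : Set S)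
    (J : Λ → Λ → ℂ) (k : ℕ) (x : Λ) :
    ∑' y : Λ, ‖J x y‖ₑ * edist (x : S) y ^ k ≤ kappa Λ J k :=
  le_iSup (fun x : Λ => ∑' y : Λ, ‖J x y‖ₑ * edist (x : S) (y : S) ^ k) x

theorem kappa_le_add {S : Type*} [PseudoEMetricSpace S] (Λ : Set S) (J : Λ → Λ → ℂ) {i j k : ℕ}
    (hij : i ≤ j) (hjk : j ≤ k) : kappa Λ J j ≤ kappa Λ J i + kappa Λ J k := by
  have hpow : ∀ r : ℝ≥0∞, r ^ j ≤ r ^ i + r ^ k := fun r => by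
    rcases le_total r 1 with hr | hr
    · exact (pow_le_pow_right_of_le_one' hr hij).trans le_self_add
    · exact (pow_le_pow_right' hr hjk).trans le_add_self
  refine iSup_le fun x => ?_
  calc ∑' y : Λ, ‖J x y‖ₑ * edist (x : S) y ^ j
      ≤ ∑' y : Λ, (‖J x y‖ₑ * edist (x : S) y ^ i + ‖J x y‖ₑ * edist (x : S) y ^ k) := by
        gcongr with y
        rw [← mul_add]
        gcongr
        exact hpow _
    _ = ∑' y : Λ, ‖J x y‖ₑ * edist (x : S) y ^ i + ∑' y : Λ, ‖J x y‖ₑ * edist (x : S) y ^ k :=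
        ENNReal.tsum_add
    _ ≤ kappa Λ J i + kappa Λ J k :=
        add_le_add (tsum_enorm_mul_edist_pow_le_kappa Λ J i x)
          (tsum_enorm_mul_edist_pow_le_kappa Λ J k x)

theorem kappa_zero_le {S : Type*} [PseudoEMetricSpace S] {Λ : Set S} {J : Λ → Λ → ℂ}
    {δ M : ℝ≥0∞} (hδ : δ ≠ 0) (hδ' : δ ≠ ∞) (hS : ∀ x y : S, x ≠ y → δ ≤ edist x y)
    (hM : ∀ x, ‖J x x‖ₑ ≤ M) : kappa Λ J 0 ≤ M + δ⁻¹ * kappa Λ J 1 := by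
  classical
  have hle : ∀ x y : Λ, ‖J x y‖ₑ * edist (x : S) y ^ 0 ≤
      (if y = x then M else 0) + δ⁻¹ * (‖J x y‖ₑ * edist (x : S) y ^ 1) := by
    intro x y
    rw [pow_zero, mul_one, pow_one]
    split_ifs with h
    · rw [h]
      exact (hM x).trans le_self_add
    · rw [zero_add, mul_left_comm]
      refine le_mul_of_one_le_right' ?_
      rw [← ENNReal.inv_mul_cancel hδ hδ']
      gcongr
      exact hS x y fun h' => h (Subtype.ext h'.symm)
  refine iSup_le fun x => (ENNReal.tsum_le_tsum (hle x)).trans ?_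
  rw [ENNReal.tsum_add, tsum_ite_eq, ENNReal.tsum_mul_left]
  gcongr
  exact tsum_enorm_mul_edist_pow_le_kappa Λ J 1 x

theorem exists_pos_forall_ne_le_dist (E : Type*) [SeminormedAddCommGroup E] [DiscreteTopology E] :
    ∃ δ : ℝ, 0 < δ ∧ ∀ x y : E, x ≠ y → δ ≤ dist x y := by
  obtain ⟨δ, hδ, h⟩ := Metric.isOpen_singleton_iff.1 (isOpen_discrete ({0} : Set E))
  refine ⟨δ, hδ, fun x y hxy => not_lt.1 fun hlt => hxy (sub_eq_zero.1 (h _ ?_))⟩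
  rwa [dist_zero_right, ← dist_eq_norm]

theorem kappa_zero_lt_top {E : Type*} [SeminormedAddCommGroup E] [DiscreteTopology E] {Λ : Set E}
    {J : Λ → Λ → ℂ} {M : ℝ} (hM : ∀ x, ‖J x x‖ ≤ M) (hκ : kappa Λ J 1 < ∞) :
    kappa Λ J 0 < ∞ := by
  obtain ⟨δ, hδ, h⟩ := exists_pos_forall_ne_le_dist E
  have hδ' : ENNReal.ofReal δ ≠ 0 := (ENNReal.ofReal_pos.2 hδ).ne'
  refine (kappa_zero_le (M := ENNReal.ofReal M) hδ' ENNReal.ofReal_ne_top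
    (fun x y hxy => ?_) fun x => ?_).trans_lt ?_
  · rw [edist_dist]
    exact ENNReal.ofReal_le_ofReal (h x y hxy)
  · rw [← ofReal_norm]
    exact ENNReal.ofReal_le_ofReal (hM x)
  · exact ENNReal.add_lt_top.2 ⟨ENNReal.ofReal_lt_top,
      ENNReal.mul_lt_top (ENNReal.inv_lt_top.2 (pos_iff_ne_zero.2 hδ')) hκ⟩

variable {S : Type*} [PseudoMetricSpace S] {Λ : Set S} {J : Λ → Λ → ℂ} {k : ℕ}

theorem toReal_enorm_mul_edist_pow (x y : Λ) :
    (‖J x y‖ₑ * edist (x : S) y ^ k).toReal = ‖J x y‖ * dist (x : S) y ^ k := by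
  rw [ENNReal.toReal_mul, ENNReal.toReal_pow, toReal_enorm, dist_edist]

theorem tsum_enorm_mul_edist_pow_ne_top (h : kappa Λ J k < ∞) (x : Λ) :
    ∑' y : Λ, ‖J x y‖ₑ * edist (x : S) y ^ k ≠ ∞ :=
  ((tsum_enorm_mul_edist_pow_le_kappa Λ J k x).trans_lt h).ne

theorem summable_norm_mul_dist_pow (h : kappa Λ J k < ∞) (x : Λ) :
    Summable fun y : Λ => ‖J x y‖ * dist (x : S) y ^ k := by
  simpa only [toReal_enorm_mul_edist_pow] using
    ENNReal.summable_toReal (tsum_enorm_mul_edist_pow_ne_top h x)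

theorem tsum_norm_mul_dist_pow_le (h : kappa Λ J k < ∞) (x : Λ) :
    ∑' y : Λ, ‖J x y‖ * dist (x : S) y ^ k ≤ (kappa Λ J k).toReal := by
  simp only [← toReal_enorm_mul_edist_pow]
  rw [← ENNReal.tsum_toReal_eq
    (ENNReal.ne_top_of_tsum_ne_top (tsum_enorm_mul_edist_pow_ne_top h x))]
  exact ENNReal.toReal_mono h.ne (tsum_enorm_mul_edist_pow_le_kappa Λ J k x)

theorem summable_norm_of_kappa_zero_lt_top (h : kappa Λ J 0 < ∞) (x : Λ) :
    Summable fun y => ‖J x y‖ := by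
  simpa only [pow_zero, mul_one] using summable_norm_mul_dist_pow h x

theorem tsum_norm_le_kappa_zero (h : kappa Λ J 0 < ∞) (x : Λ) :
    ∑' y, ‖J x y‖ ≤ (kappa Λ J 0).toReal := by
  simpa only [pow_zero, mul_one] using tsum_norm_mul_dist_pow_le h x

end Moments

/-! ### Moving fronts -/

section Front

theorem exists_pos_one_add_mul_lt {κ c : ℝ} (h : κ < c) : ∃ ε : ℝ, 0 < ε ∧ (1 + ε) * κ < c := by
  have hlim : Filter.Tendsto (fun ε : ℝ => (1 + ε) * κ) (nhdsWithin 0 (Set.Ioi 0)) (nhds κ) :=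
    tendsto_nhdsWithin_of_tendsto_nhds <| by
      simpa using (show Continuous fun ε : ℝ => (1 + ε) * κ by fun_prop).tendsto 0
  have hpos : ∀ᶠ ε : ℝ in nhdsWithin 0 (Set.Ioi 0), 0 < ε := self_mem_nhdsWithin
  exact (hpos.and (hlim.eventually_lt_const h)).exists

theorem exists_pos_add_div_pow_le {κ c : ℝ} (h : κ < c) (K : ℝ) {q : ℕ} (hq : 1 ≤ q) :
    ∃ s : ℝ, 0 < s ∧ κ + K / s ^ q ≤ c := by
  have hlim : Filter.Tendsto (fun s : ℝ => κ + K / s ^ q) Filter.atTop (nhds (κ + 0)) :=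
    tendsto_const_nhds.add
      ((Filter.tendsto_pow_atTop (Nat.one_le_iff_ne_zero.1 hq)).const_div_atTop K)
  obtain ⟨s, hs, hle⟩ := ((Filter.eventually_gt_atTop 0).and
    (hlim.eventually_lt_const (by simpa using h))).exists
  exact ⟨s, hs, hle.le⟩

variable {S : Type*} {Λ : Set S} {J : Λ → Λ → ℂ} {q : ℕ} {c s : ℝ} {h : S → ℝ}

section Hopping

variable [PseudoMetricSpace S]

theorem abs_profile_sub_mul_norm_le {ε K : ℝ} (hε : 0 ≤ ε) (hK : 0 ≤ K)
    (hprofile : ∀ r u : ℝ, |profile q r - profile q u| ≤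
      profileDeriv q r * ((1 + ε) * |r - u| + K * |r - u| ^ (q + 1)))
    (hs : 0 < s) (hh : LipschitzWith 1 h) (x y : Λ) :
    |profile q (h x / s) - profile q (h y / s)| * ‖J x y‖ ≤
      profileDeriv q (h x / s) / s * (1 + ε) * (‖J x y‖ * dist (x : S) y ^ 1) +
        profileDeriv q (h x / s) / s * (K / s ^ q) * (‖J x y‖ * dist (x : S) y ^ (q + 1)) := by
  set γ := profileDeriv q (h x / s)
  have hγ : 0 ≤ γ := profileDeriv_nonneg q _
  have hdist : |h x / s - h y / s| ≤ dist (x : S) y / s := by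
    rw [← sub_div, abs_div, abs_of_pos hs, ← Real.dist_eq]
    gcongr
    simpa using hh.dist_le_mul x y
  calc |profile q (h x / s) - profile q (h y / s)| * ‖J x y‖
      ≤ γ * ((1 + ε) * (dist (x : S) y / s) + K * (dist (x : S) y / s) ^ (q + 1)) * ‖J x y‖ := by
        refine mul_le_mul_of_nonneg_right ((hprofile _ _).trans ?_) (norm_nonneg _)
        gcongr
    _ = _ := by
        rw [div_pow, pow_succ s]
        field_simp

theorem tsum_abs_profile_sub_le {ε K : ℝ} (hε : 0 ≤ ε) (hK : 0 ≤ K)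
    (hprofile : ∀ r u : ℝ, |profile q r - profile q u| ≤
      profileDeriv q r * ((1 + ε) * |r - u| + K * |r - u| ^ (q + 1)))
    (hκ₁ : kappa Λ J 1 < ∞) (hκ : kappa Λ J (q + 1) < ∞) (hs : 0 < s) (hh : LipschitzWith 1 h)
    (x : Λ) :
    ∑' y : Λ, |profile q (h x / s) - profile q (h y / s)| * ‖J x y‖ ≤
      profileDeriv q (h x / s) / s * ((1 + ε) * (kappa Λ J 1).toReal +
        K * (kappa Λ J (q + 1)).toReal / s ^ q) := by
  set γ := profileDeriv q (h x / s)
  have hγ : 0 ≤ γ := profileDeriv_nonneg q _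
  have hpt (y : Λ) := abs_profile_sub_mul_norm_le (J := J) hε hK hprofile hs hh x y
  have hsum₁ := (summable_norm_mul_dist_pow hκ₁ x).mul_left (γ / s * (1 + ε))
  have hsum := (summable_norm_mul_dist_pow hκ x).mul_left (γ / s * (K / s ^ q))
  calc ∑' y : Λ, |profile q (h x / s) - profile q (h y / s)| * ‖J x y‖
      ≤ ∑' y : Λ, (γ / s * (1 + ε) * (‖J x y‖ * dist (x : S) y ^ 1) +
          γ / s * (K / s ^ q) * (‖J x y‖ * dist (x : S) y ^ (q + 1))) :=
        ((hsum₁.add hsum).of_nonneg_of_le (fun y => by positivity) hpt).tsum_le_tsum hpt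
          (hsum₁.add hsum)
    _ = γ / s * (1 + ε) * ∑' y : Λ, ‖J x y‖ * dist (x : S) y ^ 1 +
          γ / s * (K / s ^ q) * ∑' y : Λ, ‖J x y‖ * dist (x : S) y ^ (q + 1) := by
        rw [hsum₁.tsum_add hsum, tsum_mul_left, tsum_mul_left]
    _ ≤ γ / s * (1 + ε) * (kappa Λ J 1).toReal +
          γ / s * (K / s ^ q) * (kappa Λ J (q + 1)).toReal := by
        gcongr
        · exact tsum_norm_mul_dist_pow_le hκ₁ x
        · exact tsum_norm_mul_dist_pow_le hκ x
    _ = _ := by ring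

/-- Rescaling by `s` makes the contribution of the long jumps, of order `s ^ (-q)`, small
compared with the room between `kappa Λ J 1` and `c`. -/
theorem exists_tsum_abs_profile_sub_le (hq : 1 ≤ q) (hc : kappa Λ J 1 < ENNReal.ofReal c)
    (hκ : kappa Λ J (q + 1) < ∞) :
    ∃ s : ℝ, 0 < s ∧ ∀ {h : S → ℝ}, LipschitzWith 1 h → ∀ x : Λ,
      ∑' y : Λ, |profile q (h x / s) - profile q (h y / s)| * ‖J x y‖ ≤
        c / s * profileDeriv q (h x / s) := by
  have hκ₁ : kappa Λ J 1 < ∞ := hc.trans ENNReal.ofReal_lt_top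
  obtain ⟨ε, hε, hεc⟩ :=
    exists_pos_one_add_mul_lt ((ENNReal.lt_ofReal_iff_toReal_lt hκ₁.ne).1 hc)
  obtain ⟨K, hK, hprofile⟩ := exists_abs_profile_sub_le hq hε
  obtain ⟨s, hs, hsc⟩ := exists_pos_add_div_pow_le hεc (K * (kappa Λ J (q + 1)).toReal) hq
  refine ⟨s, hs, fun hh x =>
    (tsum_abs_profile_sub_le hε.le hK hprofile hκ₁ hκ hs hh x).trans ?_⟩
  rw [mul_comm, mul_div_assoc', div_mul_eq_mul_div]
  gcongr
  exact profileDeriv_nonneg q _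

theorem lipschitzWith_sub_const (hh : LipschitzWith 1 h) (a : ℝ) :
    LipschitzWith 1 fun x => h x - a := by
  simpa using hh.sub (LipschitzWith.const a)

end Hopping

/-- The propagation observable: a smooth version, on the scale `s`, of the indicator function of
the sites of `Λ` that are ahead of the front `h x = c * t`. -/
def front (Λ : Set S) (q : ℕ) (c s : ℝ) (h : S → ℝ) (t : ℝ) : S → ℝ :=
  Λ.indicator fun x => profile q ((h x - c * t) / s)

/-- The time derivative of `front`. -/
def frontDeriv (Λ : Set S) (q : ℕ) (c s : ℝ) (h : S → ℝ) (t : ℝ) : S → ℝ :=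
  Λ.indicator fun x => -(c / s * profileDeriv q ((h x - c * t) / s))

theorem front_apply {x : S} (hx : x ∈ Λ) (q : ℕ) (c s : ℝ) (h : S → ℝ) (t : ℝ) :
    front Λ q c s h t x = profile q ((h x - c * t) / s) :=
  Set.indicator_of_mem hx _

theorem frontDeriv_apply {x : S} (hx : x ∈ Λ) (q : ℕ) (c s : ℝ) (h : S → ℝ) (t : ℝ) :
    frontDeriv Λ q c s h t x = -(c / s * profileDeriv q ((h x - c * t) / s)) :=
  Set.indicator_of_mem hx _

theorem front_nonneg (Λ : Set S) (q : ℕ) (c s : ℝ) (h : S → ℝ) (t : ℝ) :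
    0 ≤ front Λ q c s h t :=
  Set.indicator_nonneg fun _ _ => profile_nonneg q _

theorem abs_front_le_one (Λ : Set S) (q : ℕ) (c s : ℝ) (h : S → ℝ) (t : ℝ) (x : S) :
    |front Λ q c s h t x| ≤ 1 := by
  by_cases hx : x ∈ Λ
  · rw [front_apply hx]
    exact abs_profile_le_one q _
  · simp [front, hx]

theorem frontDeriv_nonpos (hc : 0 ≤ c) (hs : 0 ≤ s) (t : ℝ) (x : S) :
    frontDeriv Λ q c s h t x ≤ 0 :=
  Set.indicator_apply_nonpos fun _ =>
    neg_nonpos.2 (mul_nonneg (div_nonneg hc hs) (profileDeriv_nonneg q _))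

theorem abs_frontDeriv_le (hc : 0 ≤ c) (hs : 0 ≤ s) (t : ℝ) (x : S) :
    |frontDeriv Λ q c s h t x| ≤ c / s * (q / 2) := by
  by_cases hx : x ∈ Λ
  · rw [abs_of_nonpos (frontDeriv_nonpos hc hs t x), frontDeriv_apply hx, neg_neg]
    gcongr
    exact profileDeriv_le q _
  · simp only [frontDeriv, hx, not_false_eq_true, Set.indicator_of_notMem, abs_zero]
    positivity

theorem abs_front_sub_sub_le (Λ : Set S) (q : ℕ) (c s : ℝ) (h : S → ℝ) (t u : ℝ) (x : S) :
    |front Λ q c s h u x - front Λ q c s h t x - frontDeriv Λ q c s h t x * (u - t)| ≤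
      q / 2 * (q + 1) * (c / s) ^ 2 * (u - t) ^ 2 := by
  by_cases hx : x ∈ Λ
  · have hlin : (h x - c * u) / s - (h x - c * t) / s = -(c / s * (u - t)) := by ring
    have hprofile := abs_profile_sub_sub_le q ((h x - c * t) / s) ((h x - c * u) / s)
    rw [hlin, neg_sq, mul_pow, ← mul_assoc] at hprofile
    rw [front_apply hx, front_apply hx, frontDeriv_apply hx]
    convert hprofile using 2
    ring
  · simp only [front, frontDeriv, hx, not_false_eq_true, Set.indicator_of_notMem, sub_self,
      zero_mul, abs_zero]
    positivity

theorem indicator_le_front_add {β a t : ℝ} (hs : 0 ≤ s) (hβ : c * t + a ≤ β) :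
    {x | x ∈ Λ ∧ β < h x}.indicator 1 ≤
      front Λ q c s h t + profile q (-(a / s)) • Λ.indicator 1 := by
  intro x
  by_cases hx : x ∈ {x | x ∈ Λ ∧ β < h x}
  · have hle : a / s ≤ (h x - c * t) / s := by
      gcongr
      linarith [hx.2]
    simp only [Pi.add_apply, Pi.smul_apply, smul_eq_mul, Set.indicator_of_mem hx,
      Set.indicator_of_mem hx.1, front_apply hx.1, Pi.one_apply, mul_one, profile_neg]
    linarith [monotone_profile q hle]
  · rw [Set.indicator_of_notMem hx]
    exact add_nonneg (front_nonneg Λ q c s h t x)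
      (mul_nonneg (profile_nonneg q _) (indicator_one_nonneg Λ x))

theorem front_zero_le {a : ℝ} (hs : 0 ≤ s) :
    front Λ q c s h 0 ≤
      {x | x ∈ Λ ∧ -a < h x}.indicator 1 + profile q (-(a / s)) • Λ.indicator 1 := by
  intro x
  by_cases hx : x ∈ Λ
  · simp only [Pi.add_apply, Pi.smul_apply, smul_eq_mul, Set.indicator_of_mem hx,
      front_apply hx, Pi.one_apply, mul_one, mul_zero, sub_zero]
    rcases lt_or_ge (-a) (h x) with hax | hax
    · rw [Set.indicator_of_mem (show x ∈ {x | x ∈ Λ ∧ -a < h x} from ⟨hx, hax⟩)]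
      exact (profile_le_one q _).trans (le_add_of_nonneg_right (profile_nonneg q _))
    · rw [← neg_div]
      exact le_add_of_nonneg_of_le (indicator_one_nonneg _ x)
        (monotone_profile q (div_le_div_of_nonneg_right hax hs))
  · simp [front, hx]

section Evolution

variable [PseudoMetricSpace S]

theorem antitone_dGammaExpect_front (hJ : ∀ x y, J y x = star (J x y)) (h₀ : kappa Λ J 0 < ∞)
    (hc : 0 ≤ c) (hs : 0 ≤ s)
    (hspeed : ∀ t (x : Λ), ∑' y : Λ, |profile q ((h x - c * t) / s) -
      profile q ((h y - c * t) / s)| * ‖J x y‖ ≤ c / s * profileDeriv q ((h x - c * t) / s))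
    (g μ : ℝ) {m : ℕ} (φ : Sector S m) :
    Antitone fun t => dGammaExpect (front Λ q c s h t) (sectorEvol Λ J g μ t m φ) := by
  refine antitone_dGammaExpect_sectorEvol (summable_norm_of_kappa_zero_lt_top h₀) hJ
    (tsum_norm_le_kappa_zero h₀) (abs_front_le_one Λ q c s h) (abs_frontDeriv_le hc hs)
    (abs_front_sub_sub_le Λ q c s h) (frontDeriv_nonpos hc hs) (fun t x => ?_) g μ φ
  simpa only [front_apply (Subtype.prop _), frontDeriv_apply (Subtype.prop _), neg_neg]
    using hspeed t x

theorem exists_particles_evol_le_add (hJ : ∀ x y, J y x = star (J x y))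
    (h₀ : kappa Λ J 0 < ∞) (hq : 1 ≤ q) (hκ : kappa Λ J (q + 1) < ∞)
    (hc : kappa Λ J 1 < ENNReal.ofReal c) :
    ∃ s : ℝ, 0 < s ∧ ∀ {h : S → ℝ}, LipschitzWith 1 h → ∀ {α β a t : ℝ}, 0 ≤ a → 0 ≤ t →
      α + c * t + 2 * a ≤ β → ∀ (g μ : ℝ) (φ : Fock S),
        particles {x | x ∈ Λ ∧ β < h x} (evol Λ J g μ t φ) ≤
          particles {x | x ∈ Λ ∧ α < h x} φ +
            ENNReal.ofReal ((1 + a / s) ^ q)⁻¹ * particles Λ φ := by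
  have hc₀ : 0 ≤ c := (ENNReal.ofReal_pos.1 (bot_le.trans_lt hc)).le
  obtain ⟨s, hs, hspeed⟩ := exists_tsum_abs_profile_sub_le hq hc hκ
  refine ⟨s, hs, fun {h} hh {α β a t} ha ht hαβ g μ φ => ?_⟩
  set k : S → ℝ := fun x => h x - (α + a)
  have hset : ∀ γ : ℝ, {x | x ∈ Λ ∧ γ < h x} = {x | x ∈ Λ ∧ γ - (α + a) < k x} := fun γ => by
    simp only [k, sub_lt_sub_iff_right]
  rw [hset α, hset β, sub_add_cancel_left, ← two_mul_profile_neg q (div_nonneg ha hs.le)]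
  refine particles_evol_le_add hJ (summable_norm_of_kappa_zero_lt_top h₀)
    (tsum_norm_le_kappa_zero h₀) (profile_nonneg q _) ht (abs_front_le_one Λ q c s k 0)
    (abs_front_le_one Λ q c s k t) (front_zero_le hs.le)
    (indicator_le_front_add hs.le (by linarith)) g μ (fun m ψ => ?_) φ
  have hk : ∀ t, LipschitzWith 1 fun x => k x - c * t := fun t =>
    lipschitzWith_sub_const (lipschitzWith_sub_const hh _) _
  have hanti := antitone_dGammaExpect_front hJ h₀ hc₀ hs.le (fun t x => hspeed (hk t) x) g μ ψ ht
  simpa only [sectorEvol_zero, one_apply_eq_self] using hanti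

end Evolution

end Front

/-! ### Propagation bounds -/

section Propagation

theorem one_le_mul_inv_pow {K ρ : ℝ} (hρ : 0 < ρ) (h : ρ ≤ K) (n : ℕ) : 1 ≤ K ^ n * (ρ ^ n)⁻¹ := by
  rw [le_mul_inv_iff₀ (pow_pos hρ n), one_mul]
  gcongr

theorem one_sub_max_mul_le_sub {B θ b ρ : ℝ} (hρ : 0 ≤ ρ) (hB : 2 * B ≤ ρ)
    (hb : b ≤ max B (θ * ρ)) : (1 - max 2⁻¹ θ) * ρ ≤ ρ - b := by
  have hmax : max B (θ * ρ) ≤ max 2⁻¹ θ * ρ := by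
    rw [max_mul_of_nonneg _ _ hρ]
    exact max_le_max_right _ (by linarith)
  linarith

theorem inv_one_add_div_pow_le {δ η s : ℝ} (hδ : 0 < δ) (hη : 0 < η) (hs : 0 < s) (n : ℕ) :
    ((1 + η * δ / s) ^ n)⁻¹ ≤ (s / η) ^ n * (δ ^ n)⁻¹ := by
  calc ((1 + η * δ / s) ^ n)⁻¹ ≤ ((η * δ / s) ^ n)⁻¹ := by
        gcongr
        exact le_add_of_nonneg_left zero_le_one
    _ = (s / η) ^ n * (δ ^ n)⁻¹ := by
        rw [← inv_pow, ← inv_pow, ← mul_pow]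
        congr 1
        field_simp

variable {S : Type*} [PseudoMetricSpace S] {Λ : Set S} {J : Λ → Λ → ℂ} {c : ℝ} {n : ℕ}

theorem particles_evol_le_add_of_one_le (hJ : ∀ x y, J y x = star (J x y))
    (h₀ : kappa Λ J 0 < ∞) {A : Set S} (hA : A ⊆ Λ) (A' : Set S) (g μ : ℝ) {t C : ℝ} (ht : 0 ≤ t)
    (hC : 1 ≤ C) (φ : Fock S) :
    particles A (evol Λ J g μ t φ) ≤ particles A' φ + ENNReal.ofReal C * particles Λ φ :=
  calc particles A (evol Λ J g μ t φ) ≤ particles Λ (evol Λ J g μ t φ) := particles_mono hA _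
    _ ≤ particles Λ φ := particles_evol_le hJ (summable_norm_of_kappa_zero_lt_top h₀)
        (tsum_norm_le_kappa_zero h₀) g μ ht φ
    _ ≤ ENNReal.ofReal C * particles Λ φ :=
        le_mul_of_one_le_left' (ENNReal.one_le_ofReal.2 hC)
    _ ≤ _ := le_add_self

theorem exists_particles_evol_le_add_inv_pow (hJ : ∀ x y, J y x = star (J x y))
    (h₀ : kappa Λ J 0 < ∞) (hκ : kappa Λ J (n + 1) < ∞) (hc : kappa Λ J 1 < ENNReal.ofReal c) :
    ∃ C : ℝ, 0 < C ∧ ∀ {h : S → ℝ}, LipschitzWith 1 h → ∀ {α β t : ℝ}, α < β → 0 ≤ t →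
      α + c * t ≤ β → ∀ (g μ : ℝ) (φ : Fock S),
        particles {x | x ∈ Λ ∧ β < h x} (evol Λ J g μ t φ) ≤
          particles {x | x ∈ Λ ∧ α < h x} φ +
            ENNReal.ofReal (C * ((β - α) ^ n)⁻¹) * particles Λ φ := by
  rcases Nat.eq_zero_or_pos n with rfl | hn
  · exact ⟨1, one_pos, fun _ _ _ _ _ ht _ g μ φ =>
      particles_evol_le_add_of_one_le hJ h₀ (fun _ hx => hx.1) _ g μ ht (by simp) φ⟩
  -- Moving at a speed `c' < c` leaves a gap proportional to `β - α` between the front and `β`.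
  obtain ⟨c', hc'κ, hc'c⟩ := ENNReal.lt_iff_exists_real_btwn.1 hc |>.imp fun _ h => h.2
  have hc₀ : 0 < c := ENNReal.ofReal_pos.1 (bot_le.trans_lt hc)
  rw [ENNReal.ofReal_lt_ofReal_iff hc₀] at hc'c
  have hc'₀ : 0 < c' := ENNReal.ofReal_pos.1 (bot_le.trans_lt hc'κ)
  obtain ⟨s, hs, hfront⟩ := exists_particles_evol_le_add hJ h₀ hn hκ hc'κ
  set η := (1 - c' / c) / 2 with hη
  have hη₀ : 0 < η := half_pos (sub_pos.2 ((div_lt_one hc₀).2 hc'c))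
  refine ⟨(s / η) ^ n, by positivity, fun {h} hh {α β t} hαβ ht hβ g μ φ => ?_⟩
  have hδ : 0 < β - α := sub_pos.2 hαβ
  have hgap : α + c' * t + 2 * (η * (β - α)) ≤ β := by
    have ht' : c' * t ≤ c' / c * (β - α) := by
      rw [div_mul_eq_mul_div, le_div_iff₀ hc₀, mul_assoc, mul_comm t]
      gcongr
      linarith
    rw [hη]
    linarith
  refine (hfront hh (by positivity) ht hgap g μ φ).trans ?_
  gcongr
  exact inv_one_add_div_pow_le hδ hη₀ hs n

end Propagation

end

end BoseHubbard

open BoseHubbard in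
theorem theorem2_general {S : Type*} [PseudoMetricSpace S] {Λ : Set S} {J : Λ → Λ → ℂ}
    (hJ : ∀ x y : Λ, J y x = star (J x y)) (h₀ : kappa Λ J 0 < ∞) {n : ℕ}
    (hκ : kappa Λ J (n + 1) < ∞) {c : ℝ} (hc : kappa Λ J 1 < ENNReal.ofReal c) (B : ℝ) {θ : ℝ}
    (hθ : θ < 1) :
    ∃ C : ℝ, 0 < C ∧ ∀ {r : S → ℝ}, LipschitzWith 1 r →
      ∀ (g μ : ℝ) (φ : Fock S) {b t ρ : ℝ}, 0 ≤ b → b ≤ max B (θ * ρ) → 0 ≤ t → b + c * t < ρ →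
        particles {x | x ∈ Λ ∧ ρ < r x} (evol Λ J g μ t φ) ≤
            particles {x | x ∈ Λ ∧ b < r x} φ
              + ENNReal.ofReal (C * (ρ ^ n)⁻¹) * particles Λ φ ∧
        particles {x | x ∈ Λ ∧ r x < b} (evol Λ J g μ t φ) ≤
            particles {x | x ∈ Λ ∧ r x < ρ} φ
              + ENNReal.ofReal (C * (ρ ^ n)⁻¹) * particles Λ φ := by
  have hc₀ : 0 < c := ENNReal.ofReal_pos.1 (bot_le.trans_lt hc)
  obtain ⟨C, hC, hprop⟩ := exists_particles_evol_le_add_inv_pow hJ h₀ hκ hc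
  set η := 1 - max 2⁻¹ θ
  have hη₀ : 0 < η := sub_pos.2 (max_lt (by norm_num) hθ)
  refine ⟨max ((2 * B) ^ n) (C * (η ^ n)⁻¹), by positivity,
    fun {r} hr g μ φ {b t ρ} hb hbB ht hρ => ?_⟩
  have hbρ : b < ρ := by linarith [mul_nonneg hc₀.le ht]
  have hρ₀ : 0 < ρ := hb.trans_lt hbρ
  have bound {h : S → ℝ} (hh : LipschitzWith 1 h) {α β : ℝ} (hαβ : β - α = ρ - b) :
      particles {x | x ∈ Λ ∧ β < h x} (evol Λ J g μ t φ) ≤ particles {x | x ∈ Λ ∧ α < h x} φ +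
        ENNReal.ofReal (max ((2 * B) ^ n) (C * (η ^ n)⁻¹) * (ρ ^ n)⁻¹) * particles Λ φ := by
    rcases le_total ρ (2 * B) with hρB | hρB
    · refine particles_evol_le_add_of_one_le hJ h₀ (fun _ hx => hx.1) _ g μ ht
        ((one_le_mul_inv_pow hρ₀ hρB n).trans ?_) φ
      gcongr
      exact le_max_left _ _
    · have hηρ : η * ρ ≤ β - α := hαβ ▸ one_sub_max_mul_le_sub hρ₀.le hρB hbB
      refine (hprop hh (show α < β by linarith) ht (by linarith) g μ φ).trans ?_
      gcongr _ + ENNReal.ofReal ?_ * _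
      calc C * ((β - α) ^ n)⁻¹ ≤ C * ((η * ρ) ^ n)⁻¹ := by gcongr
        _ = C * (η ^ n)⁻¹ * (ρ ^ n)⁻¹ := by rw [mul_pow, mul_inv, mul_assoc]
        _ ≤ _ := by
          gcongr
          exact le_max_right _ _
  refine ⟨bound hr rfl, ?_⟩
  simpa only [Pi.neg_apply, neg_lt_neg_iff] using
    bound hr.neg (α := -ρ) (β := -b) (neg_sub_neg b ρ)

open BoseHubbard in
theorem theorem2 {d : ℕ} (L : Submodule ℤ (EuclideanSpace ℝ (Fin d)))
    [DiscreteTopology L] [IsZLattice ℝ L] (Λ : Set L) (J : Λ → Λ → ℂ)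
    (hJ : ∀ x y : Λ, J y x = star (J x y))
    (hdiag : ∃ M : ℝ, ∀ x : Λ, ‖J x x‖ ≤ M)
    (p : ℕ) (hp : 1 ≤ p) (hκ : kappa Λ J p < ∞)
    (c : ℝ) (hc : kappa Λ J 1 < ENNReal.ofReal c)
    (n : ℕ) (hn : n ≤ p - 1)
    (B θ : ℝ) (hB : 0 < B) (hθ : 0 < θ) (hθ' : θ < 1) :
    ∃ C : ℝ, 0 < C ∧
      ∀ (g μ : ℝ) (_ : 0 < g) (φ : Fock L) (_ : MemDomSqrtN Λ φ)
        (b t ρ : ℝ) (_ : 0 < b) (_ : b ≤ max B (θ * ρ)) (_ : 0 < t) (_ : b + c * t < ρ),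
        particles {x : L | x ∈ Λ ∧ ρ < ‖x‖} (evol Λ J g μ t φ) ≤
            particles {x : L | x ∈ Λ ∧ b < ‖x‖} φ
              + ENNReal.ofReal (C * (ρ ^ n)⁻¹) * particles Λ φ ∧
        particles {x : L | x ∈ Λ ∧ ‖x‖ < b} (evol Λ J g μ t φ) ≤
            particles {x : L | x ∈ Λ ∧ ‖x‖ < ρ} φ
              + ENNReal.ofReal (C * (ρ ^ n)⁻¹) * particles Λ φ := by
  obtain ⟨M, hM⟩ := hdiag
  have hκ₁ : kappa Λ J 1 < ∞ := hc.trans ENNReal.ofReal_lt_top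
  have hκₙ : kappa Λ J (n + 1) < ∞ :=
    (kappa_le_add Λ J (by omega) (by omega)).trans_lt (ENNReal.add_lt_top.2 ⟨hκ₁, hκ⟩)
  obtain ⟨C, hC, h⟩ := theorem2_general hJ (kappa_zero_lt_top hM hκ₁) hκₙ hc B hθ'
  exact ⟨C, hC, fun g μ _ φ _ b t ρ hb hbB ht hρ =>
    h lipschitzWith_one_norm g μ φ hb.le hbB ht.le hρ⟩
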